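/- Setting. Let $\Omega\subset\mathbb R^4$ be open, with coordinates $(x^0,x^1,x^2,x^3)$; Greek indices run over $0,\dots,3$, Latin ones over $1,2,3$. Consider Lorentzian metrics $g=-(\theta^0)^2+\sum_i(\theta^i)^2$ with $\theta^0=U\,dx^0+b_i\,dx^i$, $\theta^i=a^i_j\,dx^j$, $U\ne0$, $\det(a^i_j)\neq0$. Let $e_\alpha$ be the dual frame, $\partial_\alpha$ the derivative along $e_\alpha$ (Pfaff derivative), so $\partial_0=U^{-1}\partial/\partial x^0$ and $\partial_i=A_i^j(\partial/\partial x^j-U^{-1}b_j\,\partial/\partial x^0)$ with $A=a^{-1}$; $\omega^\alpha_{\beta\gamma}$ the Levi-Civita connection coefficients, $\nabla_{e_\beta}e_\gamma=\omega^\alpha_{\beta\gamma}e_\alpha$; $R_{\lambda\mu,\alpha\beta}=g(R(e_\lambda,e_\mu)e_\beta,e_\alpha)$ the Riemann tensor, $R_{\mu\beta}=R_{\alpha\mu,}{}^{\alpha}{}_{\beta}$ the Ricci tensor and $R$ the scalar curvature. Put $X_{ij}=\omega^j_{i0}$ and $f_{ij}=\omega^j_{0i}$ (antisymmetric). All given fields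 are smooth. The Einstein-dust equations with the flow lines as time lines ($u=e_0$) are $R_{\alpha\beta}=\rho_{\alpha\beta}$, $\rho_{\alpha\beta}=\mu(u_\alpha u_\beta+\tfrac12 g_{\alpha\beta})$, together with $u^\alpha\nabla_\alpha u^\beta=0$ (the flow lines are geodesics) and $u^\alpha\partial_\alpha\mu+\mu\nabla_\alpha u^\alpha=0$. Modified curvature unknown: $$F_{ij,hk}=R_{ij,hk}+\delta_{ik}R_{jh}-\delta_{ih}R_{jk}-\delta_{jk}R_{ih}+\delta_{jh}R_{ik}+\tfrac12(\delta_{ih}\delta_{jk}-\delta_{ik}\delta_{jh})R .$$ The EDFF system. The unknowns are the curvature components $R_{0i,0j}$, $R_{hk,0j}$, $R_{0i,hk}$, $F_{ij,hk}$ (antisymmetric in each pair; 36 components, the symmetry under exchange of the pairs not being imposed), the connection coefficients $\omega^h_{ij}$ (with $\omega^h_{ij}=-\omega^j_{ih}$) and $X_{ij}$, the frame coefficients $a^i_j$, $b_i$, and $\mu$. The gauge variables $U\neq0$ and $f_{ij}=-f_{ji}$ are arbitrary given smooth functions on $\Omega$. Below, $\nabla$ is built from the unknown connection completed by $f$ and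 by $\omega^i_{00}=0$; $\rho_{\alpha\beta}$ is built from the unknown $\mu$; $C_{ij,hk}$ is the expression $F_{ij,hk}-R_{ij,hk}$ above with $R_{\alpha\beta}$ replaced by $\rho_{\alpha\beta}$ and $R$ by its trace; and $R_{ij,hk}$ stands for $F_{ij,hk}-C_{ij,hk}$. Components of $F$ with an index $0$ are those of the Riemann tensor, and those of $C$ are $0$. The equations are $$\nabla_0R_{hk,0j}+\nabla_kR_{0h,0j}-\nabla_hR_{0k,0j}=0,\qquad \nabla_0R^0{}_{i,0j}+\nabla_hR^h{}_{i,0j}=\nabla_0\rho_{ji}-\nabla_j\rho_{0i},$$ $$\nabla_0F_{ij,hk}+\nabla_jR_{0i,hk}-\nabla_iR_{0j,hk}=\nabla_0C_{ij,hk},\qquad \nabla_0R^0{}_{i,hj}+\nabla_kF^k{}_{i,hj}=0,$$ the expressions of $R_{0h,}{}^i{}_j$ and $R_{0h,}{}^i{}_0$ through the connection (evolution of $\omega^i_{hj}$ and $X_{hi}$), and $$\partial_0a^i_j=a^k_j(\omega^i_{k0}-\omega^i_{0k}),\qquad \partial_0b_i=U^{-1}\frac{\partial U}{\partial x^i},\qquad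 \partial_0\mu+\mu X_i{}^i=0 .$$ Theorem. For all $U$ and $f$ as above: (1) The EDFF system is a quasi FOSH (first order symmetric hyperbolic) system. That is, for differentiable unknowns $v$ with $\det(a^i_j)\ne0$ it is equivalent to a system $M^\alpha\partial_\alpha v=S(x,v)$, where $\partial_\alpha$ are the Pfaff derivatives of the frame built from $U$ and the unknowns $a,b$; the matrices $M^\alpha$ are symmetric; $M^0$ is positive definite; and $S$ is a smooth function of $x\in\Omega$ and of the undifferentiated unknowns with $\det(a^i_j)\neq 0$. In particular no space derivative of $\mu$ occurs. Moreover $M^\alpha\partial_\alpha$ consists of six identical blocks for the curvature unknowns, one for each second pair of indices, which with the first pair ordered as $12,23,31,01,02,03$ are $$\begin{pmatrix}\partial_0&0&0&\partial_2&-\partial_1&0\\0&\partial_0&0&0&\partial_3&-\partial_2\\0&0&\partial_0&-\partial_3&0&\partial_1\\\partial_2&0&-\partial_3&\partial_0&0&0\\-\partial_1&\partial_3&0&0&\partial_0&0\\0&-\partial_2&\partial_1&0&0&\partial_0\end{pmatrix},$$ and of $\partial_0$ alone for each of the other unknowns. (2) If $g$ (given by $U,a,b$) and $\mu$ are smooth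 and satisfy the Einstein-dust equations on $\Omega$ with $u=e_0$, and $\omega^j_{0i}=f_{ij}$, then the Riemann tensor (through $R_{0i,0j},R_{hk,0j},R_{0i,hk},F_{ij,hk}$), the connection and frame coefficients and $\mu$ satisfy the EDFF system, hence the quasi FOSH system of (1). -/

import Mathlib

open scoped ContDiff

/-! ### Tensor calculus in a moving frame

A point of spacetime is given by its coordinates `(x⁰, x¹, x², x³)`. Frame indices run over
`Fin 4`; the space indices `1, 2, 3` are the successors `i.succ` of `i : Fin 3`. -/

/-- The coordinate patch in which everything takes place. -/
abbrev Spacetime : Type := Fin 4 → ℝ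

/-- The Minkowski matrix `diag (-1, 1, 1, 1)`: the components of the metric in an orthonormal
frame, with lower and also with upper indices. -/
def minkowski : Matrix (Fin 4) (Fin 4) ℝ := Matrix.diagonal ![-1, 1, 1, 1]

/-- The partial derivative `∂g/∂x^α`. -/
noncomputable def partialDeriv (α : Fin 4) (g : Spacetime → ℝ) (x : Spacetime) : ℝ :=
  fderiv ℝ g x (Pi.single α 1)

/-- The Cattaneo-Ferrarese coframe `θ⁰ = U dx⁰ + b_i dxⁱ`, `θⁱ = aⁱ_j dxʲ`.
The entry `(α, ν)` is the coefficient of `dx^ν` in `θ^α`; `a i j` stands for `aⁱ_j`. -/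
def cfCoframe (U : ℝ) (a : Fin 3 → Fin 3 → ℝ) (b : Fin 3 → ℝ) : Fin 4 → Fin 4 → ℝ :=
  Fin.cases (Fin.cases U b) (fun i => Fin.cases 0 (a i))

/-- The dual frame `e_0 = U⁻¹ ∂/∂x⁰`, `e_i = A_iʲ (∂/∂xʲ - U⁻¹ b_j ∂/∂x⁰)`, with `A` the inverse
matrix of `a`. The entry `(α, ν)` is the coefficient of `∂/∂x^ν` in `e_α`. -/
noncomputable def cfFrame (U : ℝ) (a : Fin 3 → Fin 3 → ℝ) (b : Fin 3 → ℝ) :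
    Fin 4 → Fin 4 → ℝ :=
  Fin.cases (Fin.cases U⁻¹ (fun _ => 0))
    (fun i => Fin.cases (-∑ j, (Matrix.of a)⁻¹ j i * (U⁻¹ * b j)) (fun j => (Matrix.of a)⁻¹ j i))

/-- The Pfaff derivative `∂_α g` of a function in the direction of the frame vector `e_α`. -/
noncomputable def pfaff (e : Spacetime → Fin 4 → Fin 4 → ℝ) (α : Fin 4) (g : Spacetime → ℝ)
    (x : Spacetime) : ℝ :=
  ∑ ν, e x α ν * partialDeriv ν g x

/-- The structure coefficients `c^α_{βγ} = -dθ^α (e_β, e_γ)`, that is,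
`dθ^α = -(1/2) c^α_{βγ} θ^β ∧ θ^γ`. -/
noncomputable def structureCoeff (θ e : Spacetime → Fin 4 → Fin 4 → ℝ) (α β γ : Fin 4)
    (x : Spacetime) : ℝ :=
  -∑ ν, ∑ σ, e x β ν * e x γ σ *
    (partialDeriv ν (fun y => θ y α σ) x - partialDeriv σ (fun y => θ y α ν) x)

/-- `c_{βγ,λ} = η_{αλ} c^α_{βγ}`. -/
noncomputable def structureCoeffLow (θ e : Spacetime → Fin 4 → Fin 4 → ℝ) (β γ l : Fin 4)
    (x : Spacetime) : ℝ :=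
  minkowski l l * structureCoeff θ e l β γ x

/-- The Levi-Civita connection coefficients `ω_{αλ,μ} = g (∇_{e_α} e_λ, e_μ)` of the metric for
which the frame `e` (with dual coframe `θ`) is orthonormal:
`ω_{αλ,μ} = (1/2) (c_{αλ,μ} - c_{αμ,λ} - c_{λμ,α})`. -/
noncomputable def leviCivitaLow (θ e : Spacetime → Fin 4 → Fin 4 → ℝ) (α l m : Fin 4)
    (x : Spacetime) : ℝ :=
  (1 / 2) * (structureCoeffLow θ e α l m x - structureCoeffLow θ e α m l x
    - structureCoeffLow θ e l m α x)

/-- The Levi-Civita connection coefficients `ω^μ_{αλ}`. Throughout, the entry `(μ, α, λ)` of a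
connection is `ω^μ_{αλ}`, the component on `e_μ` of `∇_{e_α} e_λ`. -/
noncomputable def leviCivita (θ e : Spacetime → Fin 4 → Fin 4 → ℝ) (x : Spacetime)
    (m α l : Fin 4) : ℝ :=
  minkowski m m * leviCivitaLow θ e α l m x

/-- The curvature `R_{λμ}{}^α{}_β` of a connection `Γ`, where
`R(e_λ, e_μ) e_β = R_{λμ}{}^α{}_β e_α`. -/
noncomputable def curvature (e : Spacetime → Fin 4 → Fin 4 → ℝ)
    (Γ : Spacetime → Fin 4 → Fin 4 → Fin 4 → ℝ) (l m α β : Fin 4) (x : Spacetime) : ℝ :=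
  pfaff e l (fun y => Γ y α m β) x - pfaff e m (fun y => Γ y α l β) x
    - ∑ r, Γ x α r β * (Γ x r l m - Γ x r m l)
    + ∑ r, (Γ x α l r * Γ x r m β - Γ x α m r * Γ x r l β)

/-- The curvature with all indices lowered, `R_{λμ,αβ}`. -/
noncomputable def curvatureLow (e : Spacetime → Fin 4 → Fin 4 → ℝ)
    (Γ : Spacetime → Fin 4 → Fin 4 → Fin 4 → ℝ) (l m α β : Fin 4) (x : Spacetime) : ℝ :=
  minkowski α α * curvature e Γ l m α β x

/-- The Ricci tensor `R_{μβ} = R_{αμ}{}^α{}_β`. -/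
noncomputable def ricci (e : Spacetime → Fin 4 → Fin 4 → ℝ)
    (Γ : Spacetime → Fin 4 → Fin 4 → Fin 4 → ℝ) (x : Spacetime) (m β : Fin 4) : ℝ :=
  ∑ α, curvature e Γ α m α β x

/-- The covariant derivative `∇_α w^β` of a vector field. -/
noncomputable def covDerivVec (e : Spacetime → Fin 4 → Fin 4 → ℝ)
    (Γ : Spacetime → Fin 4 → Fin 4 → Fin 4 → ℝ) (w : Spacetime → Fin 4 → ℝ) (α β : Fin 4)
    (x : Spacetime) : ℝ :=
  pfaff e α (fun y => w y β) x + ∑ r, Γ x β α r * w x r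

/-- The covariant derivative `∇_σ T_{αβ}`. -/
noncomputable def covDerivTwo (e : Spacetime → Fin 4 → Fin 4 → ℝ)
    (Γ : Spacetime → Fin 4 → Fin 4 → Fin 4 → ℝ) (T : Spacetime → Fin 4 → Fin 4 → ℝ)
    (s α β : Fin 4) (x : Spacetime) : ℝ :=
  pfaff e s (fun y => T y α β) x - ∑ r, (Γ x r s α * T x r β + Γ x r s β * T x α r)

/-- The covariant derivative `∇_σ T_{αβ,λμ}`. -/
noncomputable def covDerivFour (e : Spacetime → Fin 4 → Fin 4 → ℝ)
    (Γ : Spacetime → Fin 4 → Fin 4 → Fin 4 → ℝ)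
    (T : Spacetime → Fin 4 → Fin 4 → Fin 4 → Fin 4 → ℝ) (s α β l m : Fin 4)
    (x : Spacetime) : ℝ :=
  pfaff e s (fun y => T y α β l m) x
    - ∑ r, (Γ x r s α * T x r β l m + Γ x r s β * T x α r l m
      + Γ x r s l * T x α β r m + Γ x r s m * T x α β l r)

/-! ### The Einstein-dust equations, with the flow lines as time lines -/

/-- The contravariant components `u^α = δ^α_0` of the flow vector: the flow lines are the time
lines. -/
def flowVec : Fin 4 → ℝ := Pi.single 0 1

/-- The covariant components `u_α` of the flow vector. -/
def flowCovec (α : Fin 4) : ℝ := ∑ β, minkowski α β * flowVec β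

/-- `ρ_{αβ} = T_{αβ} - (1/2) T g_{αβ} = μ (u_α u_β + (1/2) g_{αβ})` for the dust stress energy
tensor `T_{αβ} = μ u_α u_β`. -/
noncomputable def dustSource (μ : ℝ) (α β : Fin 4) : ℝ :=
  μ * (flowCovec α * flowCovec β + (1 / 2) * minkowski α β)

/-- The Cattaneo-Ferrarese frame as a field. -/
noncomputable def cfFrameField (U : Spacetime → ℝ) (a : Spacetime → Fin 3 → Fin 3 → ℝ)
    (b : Spacetime → Fin 3 → ℝ) : Spacetime → Fin 4 → Fin 4 → ℝ :=
  fun x => cfFrame (U x) (a x) (b x)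

/-- The Levi-Civita connection, in the Cattaneo-Ferrarese frame, of the metric
`g = -(θ⁰)² + ∑ (θⁱ)²`. -/
noncomputable def cfConnection (U : Spacetime → ℝ) (a : Spacetime → Fin 3 → Fin 3 → ℝ)
    (b : Spacetime → Fin 3 → ℝ) : Spacetime → Fin 4 → Fin 4 → Fin 4 → ℝ :=
  leviCivita (fun x => cfCoframe (U x) (a x) (b x)) (cfFrameField U a b)

/-- The Einstein-dust equations on `Ω` for the metric `g = -(θ⁰)² + ∑ (θⁱ)²` and the density `μ`,
the flow vector being `u = e_0`: the Einstein equations, the geodesic equation for the flow lines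
and the conservation of matter. -/
structure IsEinsteinDust (Ω : Set Spacetime) (U : Spacetime → ℝ)
    (a : Spacetime → Fin 3 → Fin 3 → ℝ) (b : Spacetime → Fin 3 → ℝ) (μ : Spacetime → ℝ) :
    Prop where
  einstein : ∀ x ∈ Ω, ∀ α β,
    ricci (cfFrameField U a b) (cfConnection U a b) x α β = dustSource (μ x) α β
  geodesic : ∀ x ∈ Ω, ∀ β,
    ∑ α, flowVec α *
      covDerivVec (cfFrameField U a b) (cfConnection U a b) (fun _ => flowVec) α β x = 0
  conservation : ∀ x ∈ Ω,
    ∑ α, flowVec α * pfaff (cfFrameField U a b) α μ x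
      + μ x * ∑ α, covDerivVec (cfFrameField U a b) (cfConnection U a b) (fun _ => flowVec) α α x
      = 0

/-! ### Quasi FOSH systems -/

/-- A quasilinear first order system `∑_α M^α(x, v) ∂_α v = S(x, v)` for unknowns `v` indexed by
`ι`, where the `∂_α` are Pfaff derivatives. -/
structure PfaffSystem (ι : Type) where
  /-- the principal matrices `M^α` -/
  M : Fin 4 → Spacetime → (ι → ℝ) → Matrix ι ι ℝ
  /-- the source, a function of the undifferentiated unknowns -/
  S : Spacetime → (ι → ℝ) → ι → ℝ

/-- The system is quasi FOSH on the set `D` of admissible pairs (point, value of the unknowns):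
coefficients and source are smooth there, all the `M^α` are symmetric, and `M⁰` is positive
definite. It is only "quasi" FOSH as the `∂_α` are not partial derivatives. -/
structure PfaffSystem.IsQuasiFOSH {ι : Type} [Fintype ι] (P : PfaffSystem ι)
    (D : Set (Spacetime × (ι → ℝ))) : Prop where
  smooth_principal : ∀ α i j, ContDiffOn ℝ ∞ (fun p => P.M α p.1 p.2 i j) D
  smooth_source : ContDiffOn ℝ ∞ (fun p => P.S p.1 p.2) D
  symmetric : ∀ α, ∀ p ∈ D, (P.M α p.1 p.2).IsSymm
  posDef : ∀ p ∈ D, (P.M 0 p.1 p.2).PosDef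

/-- `v` satisfies the system on `Ω`, with Pfaff derivatives taken along the frame `e` (which may
itself be built from `v`). -/
def PfaffSystem.IsSolution {ι : Type} [Fintype ι] (P : PfaffSystem ι) (Ω : Set Spacetime)
    (e : Spacetime → Fin 4 → Fin 4 → ℝ) (v : Spacetime → ι → ℝ) : Prop :=
  ∀ x ∈ Ω, ∑ α, (P.M α x (v x)).mulVec (fun i => pfaff e α (fun y => v y i) x) = P.S x (v x)

/-! ### The unknowns of the EDFF system -/

/-- The six pairs of indices that label the independent components of an antisymmetric 2-tensor. -/
def pairIdx : Fin 6 → Fin 4 × Fin 4 := ![(1, 2), (2, 3), (3, 1), (0, 1), (0, 2), (0, 3)]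

/-- The antisymmetric 2-tensor with component `1` on the pair `P`, and `0` on the other pairs. -/
def bivector (P : Fin 6) (α β : Fin 4) : ℝ :=
  (if (α, β) = pairIdx P then 1 else 0) - (if (β, α) = pairIdx P then 1 else 0)

/-- The scalar unknowns of the system:
* `(P, Q)`: the curvature unknown for the pairs `P` and `Q`, namely `R_{0i,0j}`, `R_{0i,hk}`,
  `R_{hk,0j}`, and, when both pairs are spatial, `F_{ij,hk}`;
* `(i, Q)`: the connection coefficient `ω_{iβ,γ}` for the pair `Q = (β, γ)`, namely `ω_{ij}^h`
  when `Q` is spatial and `X_{ij} = ω_{i0,j}` when `Q = (0, j)`;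
* `(i, j)`: the frame coefficient `aⁱ_j`;
* `i`: the frame coefficient `b_i`;
* `()`: the density `μ`. -/
abbrev EDFFIndex : Type :=
  (Fin 6 × Fin 6) ⊕ ((Fin 3 × Fin 6) ⊕ ((Fin 3 × Fin 3) ⊕ (Fin 3 ⊕ Unit)))

/-- The values of the unknowns at a point. -/
abbrev EDFFState : Type := EDFFIndex → ℝ

namespace EDFFState

/-- curvature unknowns -/
def curv (w : EDFFState) (P Q : Fin 6) : ℝ := w (Sum.inl (P, Q))

/-- connection unknowns -/
def conn (w : EDFFState) (i : Fin 3) (Q : Fin 6) : ℝ := w (Sum.inr (Sum.inl (i, Q)))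

/-- frame unknowns `aⁱ_j` -/
def a (w : EDFFState) (i j : Fin 3) : ℝ := w (Sum.inr (Sum.inr (Sum.inl (i, j))))

/-- frame unknowns `b_i` -/
def b (w : EDFFState) (i : Fin 3) : ℝ := w (Sum.inr (Sum.inr (Sum.inr (Sum.inl i))))

/-- the density -/
def mu (w : EDFFState) : ℝ := w (Sum.inr (Sum.inr (Sum.inr (Sum.inr ()))))

end EDFFState

/-- For a symmetric 2-tensor `r`, the difference `F_{ij,hk} - R_{ij,hk}` when `r` is the Ricci
tensor, with spatial indices:
`δ_{ik} r_{jh} - δ_{ih} r_{jk} - δ_{jk} r_{ih} + δ_{jh} r_{ik}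
  + (1/2) (δ_{ih} δ_{jk} - δ_{ik} δ_{jh}) tr r`.
The components with an index `0` are set to `0`: there `F` and `R` are the same unknown. -/
noncomputable def curvShift (r : Fin 4 → Fin 4 → ℝ) (i j h k : Fin 4) : ℝ :=
  if i = 0 ∨ j = 0 ∨ h = 0 ∨ k = 0 then 0
  else minkowski i k * r j h - minkowski i h * r j k - minkowski j k * r i h
    + minkowski j h * r i k
    + (1 / 2) * (minkowski i h * minkowski j k - minkowski i k * minkowski j h)
      * ∑ α, minkowski α α * r α α

namespace EDFFState

/-- The tensor `F_{αβ,λμ}` antisymmetric in each pair with the given components; it is `R_{αβ,λμ}`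
when one of the indices is `0`. -/
noncomputable def modifiedCurvature (w : EDFFState) (α β l m : Fin 4) : ℝ :=
  ∑ P, ∑ Q, bivector P α β * bivector Q l m * w.curv P Q

/-- The tensor `R_{αβ,λμ}` expressed through the unknowns, with `ρ_{αβ}` in place of the Ricci
tensor. -/
noncomputable def riemann (w : EDFFState) (α β l m : Fin 4) : ℝ :=
  w.modifiedCurvature α β l m - curvShift (dustSource w.mu) α β l m

/-- The coefficients `ω_{αβ,γ}` expressed through the unknowns and the gauge variable
`f_{ij} = ω_{0i,j}`, with `ω_{00,i} = 0` (geodesic time lines). -/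
noncomputable def connectionLow (f : Fin 3 → Fin 3 → ℝ) (w : EDFFState) (α β γ : Fin 4) : ℝ :=
  Fin.cases (Fin.cases 0 (fun i => Fin.cases 0 (fun j => f i j) γ) β)
    (fun i => ∑ Q, bivector Q β γ * w.conn i Q) α

/-- The connection `ω^γ_{αβ}` expressed through the unknowns and the gauge variable `f`. -/
noncomputable def connection (f : Fin 3 → Fin 3 → ℝ) (w : EDFFState) (γ α β : Fin 4) : ℝ :=
  minkowski γ γ * connectionLow f w α β γ

end EDFFState

/-- The frame built from the gauge variable `U` and the frame unknowns. -/
noncomputable def edffFrame (U : Spacetime → ℝ) (v : Spacetime → EDFFState) :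
    Spacetime → Fin 4 → Fin 4 → ℝ :=
  cfFrameField U (fun x => EDFFState.a (v x)) (fun x => EDFFState.b (v x))

/-- The connection field built from the gauge variable `f` and the connection unknowns. -/
noncomputable def edffConnection (f : Spacetime → Fin 3 → Fin 3 → ℝ) (v : Spacetime → EDFFState) :
    Spacetime → Fin 4 → Fin 4 → Fin 4 → ℝ :=
  fun x => EDFFState.connection (f x) (v x)

/-! ### The EDFF system -/

/-- The EDFF system on `Ω`, with gauge variables `U` and `f_{ij} = ω_{0i,j}`. All tensors, the
covariant derivative and the Pfaff derivatives are the ones built from the unknowns `v` and the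
gauge variables, and `ρ` is the dust source with the unknown density. -/
structure EDFFEquations (Ω : Set Spacetime) (U : Spacetime → ℝ)
    (f : Spacetime → Fin 3 → Fin 3 → ℝ) (v : Spacetime → EDFFState) : Prop where
  /-- `∇_0 R_{hk,0j} + ∇_k R_{0h,0j} - ∇_h R_{0k,0j} = 0` -/
  bianchi_zero : ∀ x ∈ Ω, ∀ h k j : Fin 3,
    covDerivFour (edffFrame U v) (edffConnection f v) (fun y => (v y).riemann)
        0 h.succ k.succ 0 j.succ x
      + covDerivFour (edffFrame U v) (edffConnection f v) (fun y => (v y).riemann)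
        k.succ 0 h.succ 0 j.succ x
      - covDerivFour (edffFrame U v) (edffConnection f v) (fun y => (v y).riemann)
        h.succ 0 k.succ 0 j.succ x = 0
  /-- `∇_0 R⁰_{i,0j} + ∇_h R^h_{i,0j} = ∇_0 ρ_{ji} - ∇_j ρ_{0i}` -/
  contracted_zero : ∀ x ∈ Ω, ∀ i j : Fin 3,
    -covDerivFour (edffFrame U v) (edffConnection f v) (fun y => (v y).riemann)
        0 0 i.succ 0 j.succ x
      + ∑ h : Fin 3, covDerivFour (edffFrame U v) (edffConnection f v) (fun y => (v y).riemann)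
        h.succ h.succ i.succ 0 j.succ x
      = covDerivTwo (edffFrame U v) (edffConnection f v) (fun y => dustSource (v y).mu)
          0 j.succ i.succ x
        - covDerivTwo (edffFrame U v) (edffConnection f v) (fun y => dustSource (v y).mu)
          j.succ 0 i.succ x
  /-- `∇_0 F_{ij,hk} + ∇_j R_{0i,hk} - ∇_i R_{0j,hk} = ∇_0 (F_{ij,hk} - R_{ij,hk})`, where on the
  right hand side the Ricci tensor is replaced by `ρ` -/
  bianchi_space : ∀ x ∈ Ω, ∀ i j h k : Fin 3,
    covDerivFour (edffFrame U v) (edffConnection f v) (fun y => (v y).modifiedCurvature)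
        0 i.succ j.succ h.succ k.succ x
      + covDerivFour (edffFrame U v) (edffConnection f v) (fun y => (v y).riemann)
        j.succ 0 i.succ h.succ k.succ x
      - covDerivFour (edffFrame U v) (edffConnection f v) (fun y => (v y).riemann)
        i.succ 0 j.succ h.succ k.succ x
      = covDerivFour (edffFrame U v) (edffConnection f v)
        (fun y => curvShift (dustSource (v y).mu)) 0 i.succ j.succ h.succ k.succ x
  /-- `∇_0 R⁰_{i,hj} + ∇_k F^k_{i,hj} = 0` -/
  contracted_space : ∀ x ∈ Ω, ∀ i h j : Fin 3,
    -covDerivFour (edffFrame U v) (edffConnection f v) (fun y => (v y).riemann)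
        0 0 i.succ h.succ j.succ x
      + ∑ k : Fin 3,
        covDerivFour (edffFrame U v) (edffConnection f v) (fun y => (v y).modifiedCurvature)
          k.succ k.succ i.succ h.succ j.succ x = 0
  /-- evolution of `ω_{hj}^i`: the expression of `R_{0h}{}^i{}_j` through the connection -/
  connection_space : ∀ x ∈ Ω, ∀ h i j : Fin 3,
    curvatureLow (edffFrame U v) (edffConnection f v) 0 h.succ i.succ j.succ x
      = (v x).riemann 0 h.succ i.succ j.succ
  /-- evolution of `X_{hi}`: the expression of `R_{0h}{}^i{}_0` through the connection -/
  connection_time : ∀ x ∈ Ω, ∀ h i : Fin 3,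
    curvatureLow (edffFrame U v) (edffConnection f v) 0 h.succ i.succ 0 x
      = (v x).riemann 0 h.succ i.succ 0
  /-- `∂_0 aⁱ_j = aᵏ_j (ω_{k0}^i - ω_{0k}^i)` -/
  frame_space : ∀ x ∈ Ω, ∀ i j : Fin 3,
    pfaff (edffFrame U v) 0 (fun y => (v y).a i j) x
      = ∑ k : Fin 3, (v x).a k j *
        (edffConnection f v x i.succ k.succ 0 - edffConnection f v x i.succ 0 k.succ)
  /-- `∂_0 b_i = U⁻¹ ∂U/∂xⁱ`, for geodesic time lines -/
  frame_time : ∀ x ∈ Ω, ∀ i : Fin 3,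
    pfaff (edffFrame U v) 0 (fun y => (v y).b i) x = (U x)⁻¹ * partialDeriv i.succ U x
  /-- `∂_0 μ + μ X_i^i = 0` -/
  density : ∀ x ∈ Ω,
    pfaff (edffFrame U v) 0 (fun y => (v y).mu) x
      + (v x).mu * ∑ i : Fin 3, edffConnection f v x i.succ i.succ 0 = 0

/-- The principal symbol of the Bianchi equations for a fixed second pair of indices, the
components being ordered as `R_{12}, R_{23}, R_{31}, R_{01}, R_{02}, R_{03}`. -/
def bianchiSymbol (ξ : Fin 4 → ℝ) : Matrix (Fin 6) (Fin 6) ℝ :=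
  !![ξ 0, 0, 0, ξ 2, -ξ 1, 0;
     0, ξ 0, 0, 0, ξ 3, -ξ 2;
     0, 0, ξ 0, -ξ 3, 0, ξ 1;
     ξ 2, 0, -ξ 3, ξ 0, 0, 0;
     -ξ 1, ξ 3, 0, 0, ξ 0, 0;
     0, -ξ 2, ξ 1, 0, 0, ξ 0]

/-- The principal matrices `M^α` of the EDFF system: six identical blocks for the curvature
unknowns, one for each second pair of indices, and `∂_0` alone for the other unknowns. -/
def edffPrincipal (α : Fin 4) : Matrix EDFFIndex EDFFIndex ℝ :=
  Matrix.fromBlocks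
    (Matrix.blockDiagonal (fun _ : Fin 6 => bianchiSymbol (Pi.single α 1))) 0 0
    (if α = 0 then 1 else 0)

/-- The admissible pairs (point, value of the unknowns): the matrix `aⁱ_j` has to be invertible. -/
def edffDomain (Ω : Set Spacetime) : Set (Spacetime × EDFFState) :=
  {p | p.1 ∈ Ω ∧ (Matrix.of (EDFFState.a p.2)).det ≠ 0}

/-- The unknowns of the EDFF system for an actual metric `g = -(θ⁰)² + ∑ (θⁱ)²` and an actual
density: the Riemann tensor (modified by the Ricci tensor into `F_{ij,hk}` for two spatial pairs),
the Levi-Civita connection and the frame coefficients. -/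
noncomputable def edffUnknowns (U : Spacetime → ℝ) (a : Spacetime → Fin 3 → Fin 3 → ℝ)
    (b : Spacetime → Fin 3 → ℝ) (μ : Spacetime → ℝ) (x : Spacetime) : EDFFState :=
  Sum.elim
    (fun PQ =>
      curvatureLow (cfFrameField U a b) (cfConnection U a b)
          (pairIdx PQ.1).1 (pairIdx PQ.1).2 (pairIdx PQ.2).1 (pairIdx PQ.2).2 x
        + curvShift (ricci (cfFrameField U a b) (cfConnection U a b) x)
          (pairIdx PQ.1).1 (pairIdx PQ.1).2 (pairIdx PQ.2).1 (pairIdx PQ.2).2)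
    (Sum.elim
      (fun iQ => minkowski (pairIdx iQ.2).2 (pairIdx iQ.2).2 *
        cfConnection U a b x (pairIdx iQ.2).2 iQ.1.succ (pairIdx iQ.2).1)
      (Sum.elim (fun ij => a x ij.1 ij.2) (Sum.elim (fun i => b x i) (fun _ => μ x))))

/-! ### Partial and Pfaff derivatives -/

section Derivatives

variable {Ω : Set Spacetime} {x : Spacetime}

/-! Conclusion (2) rests on the second Bianchi identity, used once as it stands and once contracted.
For the Levi-Civita connection of an orthonormal frame, metric compatibility and pair symmetry turn
the cyclic identity into ∇_α R^α_{i,pq} = ∇_p R_{qi} - ∇_q R_{pi} (`IsLeviCivita.second_bianchi`,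
`IsLeviCivita.contracted_bianchi`), and the Einstein equations replace the Ricci tensor by ρ. The
evolution of `a` and `b` is the vanishing of the torsion on the pairs (e_k, e_0); that of μ is the
conservation law, with div u = X_i^i because the flow lines are geodesics.

The obstacle to a symmetric system is the density: for spatial p, q the contracted identity contains
the space derivatives of μ. For dust the shift C = F - R is (μ/2)(δ_{ik} δ_{jh} - δ_{ih} δ_{jk}), a
multiple of an isotropic tensor, and its spatial divergence cancels exactly these derivatives
(`sum_covDerivFour_curvShift_dustSource`). Written with F, the equations keep only ∂_0 μ, which
equals -μ X_i^i and goes into the source.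

For conclusion (1), fix the second pair of indices. The Bianchi equations then have the principal
part of Maxwell's equations for the first pair: ∂_0 of the spatial components plus a curl, and ∂_0
of the components 0i minus a divergence. This is the displayed 6×6 symmetric matrix, with M⁰ the
identity. In R_{0h,ij} the only derivative of an unknown is ∂_0 ω_{hj,i}; the other derivative falls
on ω_{0j,i}, which is the gauge function f or zero (`curvatureLow_edff`). The symmetric system lists
one equation for each of the six ordered pairs, and antisymmetry of both sides recovers the EDFF
equations for all indices (`edffEquations_iff`). -/

theorem partialDeriv_congr (hΩ : IsOpen Ω) (hx : x ∈ Ω) {g h : Spacetime → ℝ}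
    (hgh : ∀ y ∈ Ω, g y = h y) (ν : Fin 4) : partialDeriv ν g x = partialDeriv ν h x := by
  unfold partialDeriv
  rw [Filter.EventuallyEq.fderiv_eq]
  filter_upwards [hΩ.mem_nhds hx] with y hy using hgh y hy

theorem pfaff_congr (hΩ : IsOpen Ω) (hx : x ∈ Ω) {g h : Spacetime → ℝ}
    (hgh : ∀ y ∈ Ω, g y = h y) (e : Spacetime → Fin 4 → Fin 4 → ℝ) (α : Fin 4) :
    pfaff e α g x = pfaff e α h x := by
  simp only [pfaff, partialDeriv_congr hΩ hx hgh]

variable (e : Spacetime → Fin 4 → Fin 4 → ℝ) (α : Fin 4)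

theorem pfaff_eq_fderiv (g : Spacetime → ℝ) : pfaff e α g x = fderiv ℝ g x (e x α) := by
  have h : e x α = ∑ ν, e x α ν • (Pi.single ν 1 : Spacetime) := by
    simpa using pi_eq_sum_univ' (e x α)
  conv_rhs => rw [h]
  simp [pfaff, partialDeriv]

theorem pfaff_const (c : ℝ) : pfaff e α (fun _ => c) x = 0 := by
  simp [pfaff_eq_fderiv]

theorem pfaff_neg (g : Spacetime → ℝ) : pfaff e α (fun y => -g y) x = -pfaff e α g x := by
  simp [pfaff_eq_fderiv, fderiv_fun_neg]

/-- No differentiability is needed: for c ≠ 0 the functions g and c g are differentiable at the same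
points, and elsewhere both derivatives take the default value 0. Hence expressions linear in μ can
be differentiated freely. -/
theorem pfaff_const_mul (c : ℝ) (g : Spacetime → ℝ) :
    pfaff e α (fun y => c * g y) x = c * pfaff e α g x := by
  have h := congrFun (fderiv_const_smul_field (𝕜 := ℝ) (f := g) c) x
  have h' : (c • g) = fun y => c * g y := rfl
  rw [h'] at h
  simp [pfaff_eq_fderiv, h]

theorem pfaff_add {g h : Spacetime → ℝ} (hg : DifferentiableAt ℝ g x)
    (hh : DifferentiableAt ℝ h x) :
    pfaff e α (fun y => g y + h y) x = pfaff e α g x + pfaff e α h x := by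
  simp [pfaff_eq_fderiv, fderiv_fun_add hg hh]

theorem pfaff_sub {g h : Spacetime → ℝ} (hg : DifferentiableAt ℝ g x)
    (hh : DifferentiableAt ℝ h x) :
    pfaff e α (fun y => g y - h y) x = pfaff e α g x - pfaff e α h x := by
  simp [pfaff_eq_fderiv, fderiv_fun_sub hg hh]

theorem pfaff_mul {g h : Spacetime → ℝ} (hg : DifferentiableAt ℝ g x)
    (hh : DifferentiableAt ℝ h x) :
    pfaff e α (fun y => g y * h y) x = pfaff e α g x * h x + g x * pfaff e α h x := by
  simp [pfaff_eq_fderiv, fderiv_fun_mul hg hh]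
  ring

theorem pfaff_sum {ι : Type*} [Fintype ι] {g : ι → Spacetime → ℝ}
    (hg : ∀ i, DifferentiableAt ℝ (g i) x) :
    pfaff e α (fun y => ∑ i, g i y) x = ∑ i, pfaff e α (g i) x := by
  simp [pfaff_eq_fderiv, fderiv_fun_sum (fun i _ => hg i)]

theorem pfaff_sum_mul {ι : Type*} [Fintype ι] {g h : ι → Spacetime → ℝ}
    (hg : ∀ i, DifferentiableAt ℝ (g i) x) (hh : ∀ i, DifferentiableAt ℝ (h i) x) :
    pfaff e α (fun y => ∑ i, g i y * h i y) x
      = ∑ i, (pfaff e α (g i) x * h i x + g i x * pfaff e α (h i) x) := by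
  rw [pfaff_sum e α (g := fun i y => g i y * h i y) fun i => (hg i).mul (hh i)]
  exact Finset.sum_congr rfl fun i _ => pfaff_mul e α (hg i) (hh i)

/-- The Pfaff derivative of a linear function of the unknowns. -/
theorem pfaff_linear {ι : Type} [Fintype ι] [DecidableEq ι] (φ : (ι → ℝ) →ₗ[ℝ] ℝ)
    {v : Spacetime → ι → ℝ} (hv : DifferentiableAt ℝ v x) :
    pfaff e α (fun y => φ (v y)) x = φ (fun i => pfaff e α (fun y => v y i) x) := by
  have h (w : ι → ℝ) : φ w = ∑ i, φ (Pi.single i 1) * w i := by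
    conv_lhs => rw [pi_eq_sum_univ' w]
    simp [mul_comm]
  simp only [h (v _), h (fun i => pfaff e α (fun y => v y i) x)]
  rw [pfaff_sum]
  · simp only [pfaff_const_mul]
  · intro i
    exact (differentiableAt_pi.1 hv i).const_mul _

theorem ContDiffOn.diffAt {g : Spacetime → ℝ} (hg : ContDiffOn ℝ ∞ g Ω)
    (hΩ : IsOpen Ω) (hx : x ∈ Ω) : DifferentiableAt ℝ g x :=
  (hg.contDiffAt (hΩ.mem_nhds hx)).differentiableAt (by simp)

theorem ContDiffOn.partialDeriv {g : Spacetime → ℝ} (hg : ContDiffOn ℝ ∞ g Ω)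
    (hΩ : IsOpen Ω) (ν : Fin 4) : ContDiffOn ℝ ∞ (partialDeriv ν g) Ω :=
  (hg.fderiv_of_isOpen hΩ (m := ∞) (by simp)).clm_apply contDiffOn_const

theorem ContDiffOn.pfaff {g : Spacetime → ℝ} (hg : ContDiffOn ℝ ∞ g Ω)
    (hΩ : IsOpen Ω) {e : Spacetime → Fin 4 → Fin 4 → ℝ}
    (he : ∀ α ν, ContDiffOn ℝ ∞ (fun y => e y α ν) Ω) (α : Fin 4) :
    ContDiffOn ℝ ∞ (pfaff e α g) Ω :=
  ContDiffOn.sum fun ν _ => (he α ν).mul (hg.partialDeriv hΩ ν)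

theorem partialDeriv_comm {g : Spacetime → ℝ} (hg : ContDiffOn ℝ ∞ g Ω)
    (hΩ : IsOpen Ω) (hx : x ∈ Ω) (ν σ : Fin 4) :
    partialDeriv ν (partialDeriv σ g) x = partialDeriv σ (partialDeriv ν g) x := by
  have hd : DifferentiableAt ℝ (fderiv ℝ g) x :=
    ((hg.fderiv_of_isOpen hΩ (m := ∞) (by simp)).contDiffAt (hΩ.mem_nhds hx)).differentiableAt
      (by simp)
  have h (u w : Spacetime) :
      fderiv ℝ (fun y => fderiv ℝ g y w) x u = fderiv ℝ (fderiv ℝ g) x u w := by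
    rw [fderiv_clm_apply hd (differentiableAt_const _)]
    simp
  have hs : IsSymmSndFDerivAt ℝ g x :=
    (hg.contDiffAt (hΩ.mem_nhds hx)).isSymmSndFDerivAt
      (by simpa using WithTop.coe_le_coe.2 (le_top (a := (2 : ℕ∞))))
  unfold partialDeriv
  rw [h, h]
  exact hs _ _

end Derivatives

/-! ### Commutators of frame derivatives -/

/-- Smooth dual frames on `Ω`. -/
structure IsDualFrame (Ω : Set Spacetime) (θ e : Spacetime → Fin 4 → Fin 4 → ℝ) : Prop where
  smooth_coframe : ∀ α ν, ContDiffOn ℝ ∞ (fun y => θ y α ν) Ω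
  smooth_frame : ∀ α ν, ContDiffOn ℝ ∞ (fun y => e y α ν) Ω
  dual : ∀ y ∈ Ω, ∀ α β, ∑ ν, θ y α ν * e y β ν = if α = β then 1 else 0

namespace IsDualFrame

variable {Ω : Set Spacetime} {θ e : Spacetime → Fin 4 → Fin 4 → ℝ} {x : Spacetime}

/-- A one-sided inverse of a square matrix is two-sided, so duality also gives the completeness
relation. -/
theorem dual' (H : IsDualFrame Ω θ e) (hx : x ∈ Ω) (τ σ : Fin 4) :
    ∑ α, e x α τ * θ x α σ = if τ = σ then 1 else 0 := by
  have h1 : Matrix.of (θ x) * (Matrix.of (e x)).transpose = 1 := by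
    ext α β
    simpa [Matrix.mul_apply, Matrix.one_apply] using H.dual x hx α β
  have h2 : ((Matrix.of (e x)).transpose * Matrix.of (θ x)) τ σ
      = (1 : Matrix (Fin 4) (Fin 4) ℝ) τ σ := by rw [mul_eq_one_comm.1 h1]
  simpa [Matrix.mul_apply, Matrix.one_apply] using h2

/-- Differentiating the constant θ^r(e_l) moves the derivative from the coframe to the frame:
-dθ^r(e_k, e_l) = θ^r([e_k, e_l]). -/
theorem structureCoeff_eq (H : IsDualFrame Ω θ e) (hΩ : IsOpen Ω) (hx : x ∈ Ω) (r k l : Fin 4) :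
    structureCoeff θ e r k l x
      = ∑ σ, θ x r σ * (pfaff e k (fun y => e y l σ) x - pfaff e l (fun y => e y k σ) x) := by
  have key (k l : Fin 4) : ∑ σ, e x l σ * pfaff e k (fun y => θ y r σ) x
      = -∑ σ, θ x r σ * pfaff e k (fun y => e y l σ) x := by
    have h : pfaff e k (fun y => ∑ σ, θ y r σ * e y l σ) x = 0 := by
      rw [pfaff_congr hΩ hx (fun y hy => H.dual y hy r l), pfaff_const]
    rw [pfaff_sum_mul _ _ (fun σ => (H.smooth_coframe r σ).diffAt hΩ hx)
      fun σ => (H.smooth_frame l σ).diffAt hΩ hx, Finset.sum_add_distrib] at h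
    simp only [mul_comm (e x l _)]
    linarith
  have h1 : structureCoeff θ e r k l x = -(∑ σ, e x l σ * pfaff e k (fun y => θ y r σ) x
      - ∑ σ, e x k σ * pfaff e l (fun y => θ y r σ) x) := by
    simp only [structureCoeff, pfaff, Fin.sum_univ_four]
    ring
  rw [h1, key k l, key l k]
  simp only [mul_sub, Finset.sum_sub_distrib]
  ring

theorem bracket_frame (H : IsDualFrame Ω θ e) (hΩ : IsOpen Ω) (hx : x ∈ Ω) (k l σ : Fin 4) :
    pfaff e k (fun y => e y l σ) x - pfaff e l (fun y => e y k σ) x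
      = ∑ r, structureCoeff θ e r k l x * e x r σ := by
  simp only [H.structureCoeff_eq hΩ hx, Finset.sum_mul]
  rw [Finset.sum_comm]
  have h (τ r : Fin 4) : θ x r τ *
      (pfaff e k (fun y => e y l τ) x - pfaff e l (fun y => e y k τ) x) * e x r σ
      = (e x r σ * θ x r τ) *
        (pfaff e k (fun y => e y l τ) x - pfaff e l (fun y => e y k τ) x) := by ring
  simp only [h, ← Finset.sum_mul, H.dual' hx]
  simp

theorem pfaff_comm (H : IsDualFrame Ω θ e) (hΩ : IsOpen Ω) (hx : x ∈ Ω) {g : Spacetime → ℝ}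
    (hg : ContDiffOn ℝ ∞ g Ω) (k l : Fin 4) :
    pfaff e k (pfaff e l g) x - pfaff e l (pfaff e k g) x
      = ∑ r, structureCoeff θ e r k l x * pfaff e r g x := by
  have key (k l : Fin 4) : pfaff e k (pfaff e l g) x
      = ∑ σ, pfaff e k (fun y => e y l σ) x * partialDeriv σ g x
        + ∑ σ, ∑ ν, e x l σ * e x k ν * partialDeriv ν (partialDeriv σ g) x := by
    have h : pfaff e l g = fun y => ∑ σ, e y l σ * partialDeriv σ g y := rfl
    rw [h, pfaff_sum_mul _ _ (fun σ => (H.smooth_frame l σ).diffAt hΩ hx)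
      fun σ => (hg.partialDeriv hΩ σ).diffAt hΩ hx, ← Finset.sum_add_distrib]
    refine Finset.sum_congr rfl fun σ _ => ?_
    congr 1
    rw [pfaff, Finset.mul_sum]
    exact Finset.sum_congr rfl fun ν _ => by ring
  -- The second-order part of e_k e_l g is symmetric in k and l, so only the bracket of the frame
  -- vectors survives in the commutator.
  have hs : ∑ σ, ∑ ν, e x k σ * e x l ν * partialDeriv ν (partialDeriv σ g) x
      = ∑ σ, ∑ ν, e x l σ * e x k ν * partialDeriv ν (partialDeriv σ g) x := by
    rw [Finset.sum_comm]
    refine Finset.sum_congr rfl fun σ _ => Finset.sum_congr rfl fun ν _ => ?_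
    rw [partialDeriv_comm hg hΩ hx]
    ring
  rw [key k l, key l k, hs, add_sub_add_right_eq_sub, ← Finset.sum_sub_distrib]
  simp only [← sub_mul, H.bracket_frame hΩ hx]
  simp only [pfaff, Finset.sum_mul, Finset.mul_sum]
  rw [Finset.sum_comm]
  exact Finset.sum_congr rfl fun r _ => Finset.sum_congr rfl fun σ _ => by ring

theorem structureCoeff_antisymm (r k l : Fin 4) :
    structureCoeff θ e r l k x = -structureCoeff θ e r k l x := by
  simp only [structureCoeff, Fin.sum_univ_four]
  ring

theorem smooth_structureCoeff (H : IsDualFrame Ω θ e) (hΩ : IsOpen Ω) (r k l : Fin 4) :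
    ContDiffOn ℝ ∞ (structureCoeff θ e r k l) Ω :=
  (ContDiffOn.sum fun ν _ => ContDiffOn.sum fun σ _ =>
    ((H.smooth_frame k ν).mul (H.smooth_frame l σ)).mul
      (((H.smooth_coframe r σ).partialDeriv hΩ ν).sub
        ((H.smooth_coframe r ν).partialDeriv hΩ σ))).neg

/-- The Jacobi identity for the frame vectors. -/
theorem jacobi (H : IsDualFrame Ω θ e) (hΩ : IsOpen Ω) (hx : x ∈ Ω) (s k l m : Fin 4) :
    pfaff e k (structureCoeff θ e s l m) x + pfaff e l (structureCoeff θ e s m k) x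
      + pfaff e m (structureCoeff θ e s k l) x
      = ∑ r, (structureCoeff θ e r k l x * structureCoeff θ e s r m x
        + structureCoeff θ e r l m x * structureCoeff θ e s r k x
        + structureCoeff θ e r m k x * structureCoeff θ e s r l x) := by
  set c := structureCoeff θ e with hc
  have hcd (r k l : Fin 4) : DifferentiableAt ℝ (c r k l) x :=
    (H.smooth_structureCoeff hΩ r k l).diffAt hΩ hx
  have hed (r σ : Fin 4) : DifferentiableAt ℝ (fun y => e y r σ) x :=
    (H.smooth_frame r σ).diffAt hΩ hx
  have hd (k l m σ : Fin 4) : pfaff e k (pfaff e l (fun y => e y m σ)) x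
      - pfaff e k (pfaff e m (fun y => e y l σ)) x
      = ∑ r, (pfaff e k (c r l m) x * e x r σ + c r l m x * pfaff e k (fun y => e y r σ) x) := by
    rw [← pfaff_sub]
    · rw [pfaff_congr hΩ hx (fun y hy => H.bracket_frame hΩ hy l m σ),
        pfaff_sum_mul _ _ (fun r => hcd r l m) fun r => hed r σ]
    · exact ((H.smooth_frame m σ).pfaff hΩ H.smooth_frame l).diffAt hΩ hx
    · exact ((H.smooth_frame l σ).pfaff hΩ H.smooth_frame m).diffAt hΩ hx
  -- The second derivatives of the frame components are compared in two ways: `hd` differentiates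
  -- the bracket relation, and `pfaff_comm` commutes the two derivations. In the cyclic sum the
  -- second derivatives disappear.
  have hE (σ : Fin 4) : ∑ r, (pfaff e k (c r l m) x + pfaff e l (c r m k) x
      + pfaff e m (c r k l) x) * e x r σ = ∑ r, (∑ p, (c p k l x * c r p m x
        + c p l m x * c r p k x + c p m k x * c r p l x)) * e x r σ := by
    have hb (k l m : Fin 4) : ∑ r, (∑ p, c p k l x * c r p m x) * e x r σ
        = ∑ p, c p k l x * (pfaff e p (fun y => e y m σ) x
          - pfaff e m (fun y => e y p σ) x) := by
      simp only [H.bracket_frame hΩ hx, Finset.sum_mul, Finset.mul_sum]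
      rw [Finset.sum_comm]
      exact Finset.sum_congr rfl fun r _ => Finset.sum_congr rfl fun σ _ => by ring
    simp only [Finset.sum_add_distrib, add_mul, hb]
    have h1 := hd k l m σ
    have h2 := hd l m k σ
    have h3 := hd m k l σ
    have g1 := H.pfaff_comm hΩ hx (H.smooth_frame m σ) k l
    have g2 := H.pfaff_comm hΩ hx (H.smooth_frame k σ) l m
    have g3 := H.pfaff_comm hΩ hx (H.smooth_frame l σ) m k
    rw [← hc] at g1 g2 g3
    simp only [Finset.sum_add_distrib, mul_sub, Finset.sum_sub_distrib] at h1 h2 h3 ⊢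
    linarith
  -- Pairing with θ^s extracts the coefficient of e_s from the vector identity `hE`.
  have hfin (u : Fin 4 → ℝ) : ∑ σ, (∑ r, u r * e x r σ) * θ x s σ = u s := by
    simp only [Finset.sum_mul]
    rw [Finset.sum_comm]
    have h (r σ : Fin 4) : u r * e x r σ * θ x s σ = u r * (θ x s σ * e x r σ) := by ring
    simp only [h, ← Finset.mul_sum, H.dual x hx]
    simp
  rw [← hfin (fun s => pfaff e k (c s l m) x + pfaff e l (c s m k) x + pfaff e m (c s k l) x)]
  simp only [hE]
  exact hfin (fun s => ∑ r, (c r k l x * c s r m x + c r l m x * c s r k x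
    + c r m k x * c s r l x))

end IsDualFrame

/-! ### The Bianchi identities -/

theorem minkowski_mul_self (α : Fin 4) : minkowski α α * minkowski α α = 1 := by
  fin_cases α <;> simp [minkowski]

theorem curvature_antisymm (e : Spacetime → Fin 4 → Fin 4 → ℝ)
    (Γ : Spacetime → Fin 4 → Fin 4 → Fin 4 → ℝ) (l m α β : Fin 4) (x : Spacetime) :
    curvature e Γ m l α β x = -curvature e Γ l m α β x := by
  simp only [curvature, Fin.sum_univ_four]
  ring

theorem curvatureLow_antisymm_left (e : Spacetime → Fin 4 → Fin 4 → ℝ)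
    (Γ : Spacetime → Fin 4 → Fin 4 → Fin 4 → ℝ) (l m α β : Fin 4) (x : Spacetime) :
    curvatureLow e Γ m l α β x = -curvatureLow e Γ l m α β x := by
  simp only [curvatureLow, curvature_antisymm e Γ l m, mul_neg]

/-- The curvature of a metric connection is antisymmetric in its second pair of indices. -/
theorem curvatureLow_antisymm_right {Ω : Set Spacetime} (hΩ : IsOpen Ω)
    {e : Spacetime → Fin 4 → Fin 4 → ℝ} {Γ : Spacetime → Fin 4 → Fin 4 → Fin 4 → ℝ}
    (hΓ : ∀ y ∈ Ω, ∀ α β γ, minkowski γ γ * Γ y γ α β = -(minkowski β β * Γ y β α γ))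
    {x : Spacetime} (hx : x ∈ Ω) (l m α β : Fin 4) :
    curvatureLow e Γ l m β α x = -curvatureLow e Γ l m α β x := by
  have hd (k n : Fin 4) : minkowski β β * pfaff e k (fun y => Γ y β n α) x
      = -(minkowski α α * pfaff e k (fun y => Γ y α n β) x) := by
    rw [← pfaff_const_mul, ← pfaff_const_mul, ← pfaff_neg]
    exact pfaff_congr hΩ hx (fun y hy => hΓ y hy n α β) e k
  have h1 : minkowski β β * ∑ r, Γ x β r α * (Γ x r l m - Γ x r m l)
      = -(minkowski α α * ∑ r, Γ x α r β * (Γ x r l m - Γ x r m l)) := by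
    simp only [Finset.mul_sum, ← Finset.sum_neg_distrib]
    refine Finset.sum_congr rfl fun r _ => ?_
    have := hΓ x hx r α β
    linear_combination (Γ x r l m - Γ x r m l) * this
  -- Two uses of metric compatibility transpose a product of connection matrices, so the two
  -- quadratic terms of the curvature exchange their roles.
  have h2 (l m : Fin 4) : minkowski β β * ∑ r, Γ x β l r * Γ x r m α
      = minkowski α α * ∑ r, Γ x α m r * Γ x r l β := by
    simp only [Finset.mul_sum]
    refine Finset.sum_congr rfl fun r _ => ?_
    have e1 := hΓ x hx l r β
    have e2 := hΓ x hx m r α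
    linear_combination Γ x r m α * e1 - Γ x r l β * e2
  have h3 := h2 l m
  have h4 := h2 m l
  have d1 := hd l m
  have d2 := hd m l
  simp only [curvatureLow, curvature, mul_add, mul_sub, Finset.sum_sub_distrib] at h1 h3 h4 ⊢
  linarith

/-- The second Bianchi identity, as an identity between the values at a point of matrices `G k` of
connection coefficients, structure coefficients `c`, and their frame derivatives. -/
theorem bianchi_algebra {A n : Type*} [Ring A] [Algebra ℝ A] [Fintype n]
    {G : n → A} {dG : n → n → A} {ddG : n → n → n → A} {c : n → n → n → ℝ}
    {dc : n → n → n → n → ℝ} {O : n → n → A} {dO : n → n → n → A}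
    (hO : ∀ l m, O l m = dG l m - dG m l - ∑ r, c r l m • G r + (G l * G m - G m * G l))
    (hdO : ∀ k l m, dO k l m = ddG k l m - ddG k m l
      - ∑ r, (dc k r l m • G r + c r l m • dG k r)
      + (dG k l * G m + G l * dG k m - (dG k m * G l + G m * dG k l)))
    (hcomm : ∀ k l m, ddG k l m - ddG l k m = ∑ r, c r k l • dG r m)
    (hjac : ∀ s k l m, dc k s l m + dc l s m k + dc m s k l
      = ∑ r, (c r k l * c s r m + c r l m * c s r k + c r m k * c s r l)) (k l m : n) :
    (dO k l m + G k * O l m - O l m * G k - ∑ r, c r k l • O r m)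
      + (dO l m k + G l * O m k - O m k * G l - ∑ r, c r l m • O r k)
      + (dO m k l + G m * O k l - O k l * G m - ∑ r, c r m k • O r l) = 0 := by
  have hc (k l m : n) : ∑ r, c r k l • O r m = ∑ r, c r k l • dG r m - ∑ r, c r k l • dG m r
      - ∑ s, (∑ r, c r k l * c s r m) • G s
      + ((∑ r, c r k l • G r) * G m - G m * ∑ r, c r k l • G r) := by
    simp only [hO, smul_add, smul_sub, Finset.sum_add_distrib, Finset.sum_sub_distrib,
      Finset.sum_mul, Finset.mul_sum, smul_mul_assoc, mul_smul_comm, Finset.smul_sum, smul_smul,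
      Finset.sum_smul]
    congr 2
    exact Finset.sum_comm
  have hj : ∑ s, dc k s l m • G s + ∑ s, dc l s m k • G s + ∑ s, dc m s k l • G s
      = ∑ s, (∑ r, c r k l * c s r m) • G s + ∑ s, (∑ r, c r l m * c s r k) • G s
        + ∑ s, (∑ r, c r m k * c s r l) • G s := by
    simp only [← Finset.sum_add_distrib, ← add_smul, hjac]
  have h1 := hcomm k l m
  have h2 := hcomm l m k
  have h3 := hcomm m k l
  simp only [hc, hdO, Finset.sum_add_distrib]
  rw [hO l m, hO m k, hO k l]
  -- Associativity removes the cubic terms in G and the products G·dG. The second derivatives are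
  -- left to the commutation relations, and the derivatives of c to the Jacobi identity.
  linear_combination (norm := noncomm_ring) h1 + h2 + h3 - hj

/-- `Γ` is the Levi-Civita connection on `Ω` of the metric for which the frame `e` is orthonormal. -/
structure IsLeviCivita (Ω : Set Spacetime) (θ e : Spacetime → Fin 4 → Fin 4 → ℝ)
    (Γ : Spacetime → Fin 4 → Fin 4 → Fin 4 → ℝ) : Prop extends IsDualFrame Ω θ e where
  smooth : ∀ γ α β, ContDiffOn ℝ ∞ (fun y => Γ y γ α β) Ω
  metric : ∀ y ∈ Ω, ∀ α β γ, minkowski γ γ * Γ y γ α β = -(minkowski β β * Γ y β α γ)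
  torsion : ∀ y ∈ Ω, ∀ γ α β, Γ y γ α β - Γ y γ β α = structureCoeff θ e γ α β y

namespace IsLeviCivita

variable {Ω : Set Spacetime} {θ e : Spacetime → Fin 4 → Fin 4 → ℝ}
  {Γ : Spacetime → Fin 4 → Fin 4 → Fin 4 → ℝ} {x : Spacetime}

theorem diffAt (H : IsLeviCivita Ω θ e Γ) (hΩ : IsOpen Ω) (hx : x ∈ Ω) (γ α β : Fin 4) :
    DifferentiableAt ℝ (fun y => Γ y γ α β) x :=
  (H.smooth γ α β).diffAt hΩ hx

theorem curvature_eq (H : IsLeviCivita Ω θ e Γ) (hx : x ∈ Ω) (l m α β : Fin 4) :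
    curvature e Γ l m α β x
      = pfaff e l (fun y => Γ y α m β) x - pfaff e m (fun y => Γ y α l β) x
        - ∑ r, structureCoeff θ e r l m x * Γ x α r β
        + (∑ r, Γ x α l r * Γ x r m β - ∑ r, Γ x α m r * Γ x r l β) := by
  simp only [curvature, H.torsion x hx, Finset.sum_sub_distrib, mul_comm (Γ x α _ β)]

/-- Vanishing torsion pairs the derivatives of Γ in the cyclic sum into derivatives of the structure
coefficients, so this is the Jacobi identity for the frame. -/
theorem first_bianchi (H : IsLeviCivita Ω θ e Γ) (hΩ : IsOpen Ω) (hx : x ∈ Ω)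
    (l m β α : Fin 4) :
    curvature e Γ l m α β x + curvature e Γ m β α l x + curvature e Γ β l α m x = 0 := by
  have hd (l m β : Fin 4) : pfaff e l (fun y => Γ y α m β) x - pfaff e l (fun y => Γ y α β m) x
      = pfaff e l (structureCoeff θ e α m β) x := by
    rw [← pfaff_sub _ _ (H.diffAt hΩ hx α m β) (H.diffAt hΩ hx α β m)]
    exact pfaff_congr hΩ hx (fun y hy => H.torsion y hy α m β) e l
  have hJ := H.jacobi hΩ hx α l m β
  have d1 := hd l m β
  have d2 := hd m β l
  have d3 := hd β l m
  have hq (l m β : Fin 4) : ∑ r, structureCoeff θ e r l m x * structureCoeff θ e α r β x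
      = ∑ r, structureCoeff θ e r l m x * Γ x α r β
        - (∑ r, Γ x α β r * Γ x r l m - ∑ r, Γ x α β r * Γ x r m l) := by
    simp only [← H.torsion x hx, ← Finset.sum_sub_distrib]
    exact Finset.sum_congr rfl fun r _ => by ring
  have q1 := hq l m β
  have q2 := hq m β l
  have q3 := hq β l m
  simp only [H.curvature_eq hx, Finset.sum_add_distrib] at hJ ⊢
  linarith

theorem curvatureLow_antisymm (H : IsLeviCivita Ω θ e Γ) (hΩ : IsOpen Ω) (hx : x ∈ Ω)
    (l m α β : Fin 4) : curvatureLow e Γ l m β α x = -curvatureLow e Γ l m α β x :=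
  curvatureLow_antisymm_right hΩ H.metric hx l m α β

/-- The classical octahedron argument: four instances of the first Bianchi identity are combined,
and the antisymmetry in each pair cancels everything but the two terms compared. -/
theorem curvatureLow_pair_symm (H : IsLeviCivita Ω θ e Γ) (hΩ : IsOpen Ω) (hx : x ∈ Ω)
    (l m α β : Fin 4) : curvatureLow e Γ l m α β x = curvatureLow e Γ α β l m x := by
  have hb (l m β α : Fin 4) : curvatureLow e Γ l m α β x + curvatureLow e Γ m β α l x
      + curvatureLow e Γ β l α m x = 0 := by
    have := H.first_bianchi hΩ hx l m β α
    simp only [curvatureLow]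
    linear_combination minkowski α α * this
  have b1 := hb l m β α
  have b2 := hb m β α l
  have b3 := hb β α l m
  have b4 := hb α l m β
  have s1 := fun l m => curvatureLow_antisymm_left e Γ l m
  have s2 := H.curvatureLow_antisymm hΩ hx
  linarith [s2 l m β α, s2 m β l α, s2 β l m α, s2 m α β l, s2 α β m l, s2 l α β m, s2 β m l α,
    s1 α β l m x, s1 α β m l x, s1 m α l β x, s1 l α m β x, s1 l α β m x, s1 m α β l x,
    s1 l m α β x, s1 m β α l x, s1 β l α m x, s1 m β l α x, s1 β l m α x, s2 l α m β,
    s2 m α l β, s2 α l m β]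

theorem smooth_curvature (H : IsLeviCivita Ω θ e Γ) (hΩ : IsOpen Ω) (l m α β : Fin 4) :
    ContDiffOn ℝ ∞ (curvature e Γ l m α β) Ω := by
  have hG := H.smooth
  have hp (k m : Fin 4) := (hG α m β).pfaff hΩ H.smooth_frame k
  exact (((hp l m).sub (hp m l)).sub
    (ContDiffOn.sum fun r _ => (hG α r β).mul ((hG r l m).sub (hG r m l)))).add
      (ContDiffOn.sum fun r _ => ((hG α l r).mul (hG r m β)).sub ((hG α m r).mul (hG r l β)))

theorem smooth_curvatureLow (H : IsLeviCivita Ω θ e Γ) (hΩ : IsOpen Ω) (l m α β : Fin 4) :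
    ContDiffOn ℝ ∞ (curvatureLow e Γ l m α β) Ω :=
  contDiffOn_const.mul (H.smooth_curvature hΩ l m α β)

theorem pfaff_curvature (H : IsLeviCivita Ω θ e Γ) (hΩ : IsOpen Ω) (hx : x ∈ Ω)
    (k l m α β : Fin 4) :
    pfaff e k (curvature e Γ l m α β) x
      = pfaff e k (pfaff e l (fun y => Γ y α m β)) x - pfaff e k (pfaff e m (fun y => Γ y α l β)) x
        - ∑ r, (pfaff e k (structureCoeff θ e r l m) x * Γ x α r β
          + structureCoeff θ e r l m x * pfaff e k (fun y => Γ y α r β) x)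
        + (∑ r, (pfaff e k (fun y => Γ y α l r) x * Γ x r m β
            + Γ x α l r * pfaff e k (fun y => Γ y r m β) x)
          - ∑ r, (pfaff e k (fun y => Γ y α m r) x * Γ x r l β
            + Γ x α m r * pfaff e k (fun y => Γ y r l β) x)) := by
  have hG := H.diffAt hΩ hx
  have hc (r : Fin 4) := (H.smooth_structureCoeff hΩ r l m).diffAt hΩ hx
  have hp (k m : Fin 4) := ((H.smooth α m β).pfaff hΩ H.smooth_frame k).diffAt hΩ hx
  have hq (l m : Fin 4) : DifferentiableAt ℝ (fun y => ∑ r, Γ y α l r * Γ y r m β) x :=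
    DifferentiableAt.fun_sum fun r _ => (hG α l r).mul (hG r m β)
  have hcs : DifferentiableAt ℝ (fun y => ∑ r, structureCoeff θ e r l m y * Γ y α r β) x :=
    DifferentiableAt.fun_sum fun r _ => (hc r).mul (hG α r β)
  rw [pfaff_congr hΩ hx (fun y hy => H.curvature_eq hy l m α β)]
  rw [pfaff_add _ _ (((hp l m).fun_sub (hp m l)).fun_sub hcs) ((hq l m).fun_sub (hq m l)),
    pfaff_sub _ _ ((hp l m).fun_sub (hp m l)) hcs, pfaff_sub _ _ (hq l m) (hq m l),
    pfaff_sub _ _ (hp l m) (hp m l), pfaff_sum_mul _ _ hc fun r => hG α r β,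
    pfaff_sum_mul _ _ (fun r => hG α l r) fun r => hG r m β,
    pfaff_sum_mul _ _ (fun r => hG α m r) fun r => hG r l β]

/-- Curvature is treated as a matrix-valued 2-form with matrix indices α, β. The connection acts on
these by a commutator, while the form indices k, l, m see only the structure coefficients. In this
form the identity is purely algebraic, as in `bianchi_algebra`. -/
theorem second_bianchi_mixed (H : IsLeviCivita Ω θ e Γ) (hΩ : IsOpen Ω) (hx : x ∈ Ω)
    (k l m α β : Fin 4) :
    (pfaff e k (curvature e Γ l m α β) x + ∑ r, Γ x α k r * curvature e Γ l m r β x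
        - ∑ r, curvature e Γ l m α r x * Γ x r k β
        - ∑ r, structureCoeff θ e r k l x * curvature e Γ r m α β x)
      + (pfaff e l (curvature e Γ m k α β) x + ∑ r, Γ x α l r * curvature e Γ m k r β x
        - ∑ r, curvature e Γ m k α r x * Γ x r l β
        - ∑ r, structureCoeff θ e r l m x * curvature e Γ r k α β x)
      + (pfaff e m (curvature e Γ k l α β) x + ∑ r, Γ x α m r * curvature e Γ k l r β x
        - ∑ r, curvature e Γ k l α r x * Γ x r m β
        - ∑ r, structureCoeff θ e r m k x * curvature e Γ r l α β x) = 0 := by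
  have h := bianchi_algebra (A := Matrix (Fin 4) (Fin 4) ℝ)
    (G := fun m => Matrix.of fun α β => Γ x α m β)
    (dG := fun k m => Matrix.of fun α β => pfaff e k (fun y => Γ y α m β) x)
    (ddG := fun k l m => Matrix.of fun α β => pfaff e k (pfaff e l (fun y => Γ y α m β)) x)
    (c := fun r l m => structureCoeff θ e r l m x)
    (dc := fun k r l m => pfaff e k (structureCoeff θ e r l m) x)
    (O := fun l m => Matrix.of fun α β => curvature e Γ l m α β x)
    (dO := fun k l m => Matrix.of fun α β => pfaff e k (curvature e Γ l m α β) x)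
    (fun l m => by
      ext α β
      simp [Matrix.mul_apply, Matrix.sum_apply, H.curvature_eq hx])
    (fun k l m => by
      ext α β
      simp [Matrix.mul_apply, Matrix.sum_apply, H.pfaff_curvature hΩ hx, Finset.sum_add_distrib])
    (fun k l m => by
      ext α β
      simpa [Matrix.sum_apply] using H.pfaff_comm hΩ hx (H.smooth α m β) k l)
    (fun s k l m => H.jacobi hΩ hx s k l m) k l m
  have h' := congrFun (congrFun h α) β
  simpa [Matrix.mul_apply, Matrix.sum_apply] using h'

/-- In the cyclic sum, the connection terms of ∇ on the two form indices combine into Γ^r_{kl} -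
Γ^r_{lk}, which are the structure coefficients of the mixed form. -/
theorem second_bianchi (H : IsLeviCivita Ω θ e Γ) (hΩ : IsOpen Ω) (hx : x ∈ Ω)
    (k l m α β : Fin 4) :
    covDerivFour e Γ (fun y l m α β => curvatureLow e Γ l m α β y) k l m α β x
      + covDerivFour e Γ (fun y l m α β => curvatureLow e Γ l m α β y) l m k α β x
      + covDerivFour e Γ (fun y l m α β => curvatureLow e Γ l m α β y) m k l α β x = 0 := by
  have hcov (k l m : Fin 4) :
      covDerivFour e Γ (fun y l m α β => curvatureLow e Γ l m α β y) k l m α β x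
        = minkowski α α * (pfaff e k (curvature e Γ l m α β) x
          + ∑ r, Γ x α k r * curvature e Γ l m r β x - ∑ r, curvature e Γ l m α r x * Γ x r k β
          - ∑ r, (Γ x r k l * curvature e Γ r m α β x - Γ x r k m * curvature e Γ r l α β x)) := by
    -- Metric compatibility: lowering α commutes with ∇_k.
    have hm : ∑ r, Γ x r k α * (minkowski r r * curvature e Γ l m r β x)
        = -(minkowski α α * ∑ r, Γ x α k r * curvature e Γ l m r β x) := by
      rw [Finset.mul_sum, ← Finset.sum_neg_distrib]
      refine Finset.sum_congr rfl fun r _ => ?_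
      linear_combination curvature e Γ l m r β x * H.metric x hx k α r
    have hl : ∑ r, Γ x r k m * (minkowski α α * curvature e Γ l r α β x)
        = -(minkowski α α * ∑ r, Γ x r k m * curvature e Γ r l α β x) := by
      rw [Finset.mul_sum, ← Finset.sum_neg_distrib]
      refine Finset.sum_congr rfl fun r _ => ?_
      rw [curvature_antisymm e Γ r l]
      ring
    have h1 (f g : Fin 4 → ℝ) : ∑ r, f r * (minkowski α α * g r)
        = minkowski α α * ∑ r, f r * g r := by
      rw [Finset.mul_sum]
      exact Finset.sum_congr rfl fun r _ => by ring
    have h2 : ∑ r, curvature e Γ l m α r x * Γ x r k β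
        = ∑ r, Γ x r k β * curvature e Γ l m α r x :=
      Finset.sum_congr rfl fun r _ => mul_comm _ _
    have hp : pfaff e k (fun y => minkowski α α * curvature e Γ l m α β y) x
        = minkowski α α * pfaff e k (curvature e Γ l m α β) x := pfaff_const_mul _ _ _ _
    simp only [covDerivFour, curvatureLow, Finset.sum_add_distrib, hm, hl, hp, h2,
      Finset.sum_sub_distrib]
    rw [h1, h1]
    ring
  have h := H.second_bianchi_mixed hΩ hx k l m α β
  simp only [← H.torsion x hx, sub_mul, Finset.sum_sub_distrib] at h
  simp only [hcov, Finset.sum_sub_distrib]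
  linear_combination minkowski α α * h

end IsLeviCivita

/-! ### The contracted Bianchi identity -/

theorem covDerivFour_congr {Ω : Set Spacetime} (hΩ : IsOpen Ω) {x : Spacetime} (hx : x ∈ Ω)
    (e : Spacetime → Fin 4 → Fin 4 → ℝ) {Γ Γ' : Spacetime → Fin 4 → Fin 4 → Fin 4 → ℝ}
    {T T' : Spacetime → Fin 4 → Fin 4 → Fin 4 → Fin 4 → ℝ} (hΓ : Γ x = Γ' x)
    (hT : ∀ y ∈ Ω, T y = T' y) (s α β l m : Fin 4) :
    covDerivFour e Γ T s α β l m x = covDerivFour e Γ' T' s α β l m x := by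
  simp only [covDerivFour, hΓ, hT x hx,
    pfaff_congr hΩ hx (fun y hy => by rw [hT y hy] : ∀ y ∈ Ω, T y α β l m = T' y α β l m)]

theorem covDerivTwo_congr {Ω : Set Spacetime} (hΩ : IsOpen Ω) {x : Spacetime} (hx : x ∈ Ω)
    (e : Spacetime → Fin 4 → Fin 4 → ℝ) {Γ Γ' : Spacetime → Fin 4 → Fin 4 → Fin 4 → ℝ}
    {T T' : Spacetime → Fin 4 → Fin 4 → ℝ} (hΓ : Γ x = Γ' x)
    (hT : ∀ y ∈ Ω, T y = T' y) (s α β : Fin 4) :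
    covDerivTwo e Γ T s α β x = covDerivTwo e Γ' T' s α β x := by
  simp only [covDerivTwo, hΓ, hT x hx,
    pfaff_congr hΩ hx (fun y hy => by rw [hT y hy] : ∀ y ∈ Ω, T y α β = T' y α β)]

theorem covDerivFour_add {e : Spacetime → Fin 4 → Fin 4 → ℝ}
    {Γ : Spacetime → Fin 4 → Fin 4 → Fin 4 → ℝ}
    {T T' : Spacetime → Fin 4 → Fin 4 → Fin 4 → Fin 4 → ℝ} {x : Spacetime} {α β l m : Fin 4}
    (hT : DifferentiableAt ℝ (fun y => T y α β l m) x)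
    (hT' : DifferentiableAt ℝ (fun y => T' y α β l m) x) (s : Fin 4) :
    covDerivFour e Γ (fun y α β l m => T y α β l m + T' y α β l m) s α β l m x
      = covDerivFour e Γ T s α β l m x + covDerivFour e Γ T' s α β l m x := by
  simp only [covDerivFour, pfaff_add _ _ hT hT', Finset.sum_add_distrib, mul_add]
  ring

theorem covDerivFour_antisymm_left {Ω : Set Spacetime} (hΩ : IsOpen Ω) {x : Spacetime}
    (hx : x ∈ Ω) (e : Spacetime → Fin 4 → Fin 4 → ℝ) (Γ : Spacetime → Fin 4 → Fin 4 → Fin 4 → ℝ)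
    {T : Spacetime → Fin 4 → Fin 4 → Fin 4 → Fin 4 → ℝ}
    (hT : ∀ y ∈ Ω, ∀ α β l m, T y β α l m = -T y α β l m) (s α β l m : Fin 4) :
    covDerivFour e Γ T s β α l m x = -covDerivFour e Γ T s α β l m x := by
  simp only [covDerivFour, pfaff_congr hΩ hx (fun y hy => hT y hy α β l m), pfaff_neg]
  rw [neg_sub', sub_right_inj, ← Finset.sum_neg_distrib]
  refine Finset.sum_congr rfl fun r _ => ?_
  rw [hT x hx r α, hT x hx β r, hT x hx α β r m, hT x hx α β l r]
  ring

theorem covDerivFour_antisymm_right {Ω : Set Spacetime} (hΩ : IsOpen Ω) {x : Spacetime}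
    (hx : x ∈ Ω) (e : Spacetime → Fin 4 → Fin 4 → ℝ) (Γ : Spacetime → Fin 4 → Fin 4 → Fin 4 → ℝ)
    {T : Spacetime → Fin 4 → Fin 4 → Fin 4 → Fin 4 → ℝ}
    (hT : ∀ y ∈ Ω, ∀ α β l m, T y α β m l = -T y α β l m) (s α β l m : Fin 4) :
    covDerivFour e Γ T s α β m l x = -covDerivFour e Γ T s α β l m x := by
  simp only [covDerivFour, pfaff_congr hΩ hx (fun y hy => hT y hy α β l m), pfaff_neg]
  rw [neg_sub', sub_right_inj, ← Finset.sum_neg_distrib]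
  refine Finset.sum_congr rfl fun r _ => ?_
  rw [hT x hx r β, hT x hx α r, hT x hx α β r m, hT x hx α β l r]
  ring

namespace IsLeviCivita

variable {Ω : Set Spacetime} {θ e : Spacetime → Fin 4 → Fin 4 → ℝ}
  {Γ : Spacetime → Fin 4 → Fin 4 → Fin 4 → ℝ} {x : Spacetime}

theorem covDeriv_pair_symm (H : IsLeviCivita Ω θ e Γ) (hΩ : IsOpen Ω) (hx : x ∈ Ω)
    (s l m α β : Fin 4) :
    covDerivFour e Γ (fun y l m α β => curvatureLow e Γ l m α β y) s l m α β x
      = covDerivFour e Γ (fun y l m α β => curvatureLow e Γ l m α β y) s α β l m x := by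
  simp only [covDerivFour, pfaff_congr hΩ hx
    (fun y hy => H.curvatureLow_pair_symm hΩ hy l m α β)]
  rw [sub_right_inj]
  refine Finset.sum_congr rfl fun r _ => ?_
  rw [H.curvatureLow_pair_symm hΩ hx r m, H.curvatureLow_pair_symm hΩ hx l r,
    H.curvatureLow_pair_symm hΩ hx l m r, H.curvatureLow_pair_symm hΩ hx l m α]
  ring

theorem covDeriv_ricci (H : IsLeviCivita Ω θ e Γ) (hΩ : IsOpen Ω) (hx : x ∈ Ω)
    (k m β : Fin 4) :
    covDerivTwo e Γ (fun y => ricci e Γ y) k m β x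
      = ∑ α, minkowski α α *
        covDerivFour e Γ (fun y l m α β => curvatureLow e Γ l m α β y) k α m α β x := by
  have hr (y : Spacetime) (m β : Fin 4) :
      ricci e Γ y m β = ∑ α, minkowski α α * curvatureLow e Γ α m α β y := by
    refine Finset.sum_congr rfl fun α _ => ?_
    rw [curvatureLow, ← mul_assoc, minkowski_mul_self, one_mul]
  have hp : pfaff e k (fun y => ricci e Γ y m β) x
      = ∑ α, minkowski α α * pfaff e k (curvatureLow e Γ α m α β) x := by
    simp only [hr]
    rw [pfaff_sum e k (g := fun α y => minkowski α α * curvatureLow e Γ α m α β y) fun α =>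
      ((H.smooth_curvatureLow hΩ α m α β).diffAt hΩ hx).const_mul _]
    exact Finset.sum_congr rfl fun α _ => pfaff_const_mul _ _ _ _
  -- The connection terms on the two contracted indices cancel, since ω is antisymmetric once its
  -- upper index is lowered; thus ∇ commutes with the trace.
  have h0 : ∑ α, ∑ r, minkowski α α * (Γ x r k α * curvatureLow e Γ r m α β x)
      + ∑ α, ∑ r, minkowski α α * (Γ x r k α * curvatureLow e Γ α m r β x) = 0 := by
    rw [Finset.sum_comm, ← Finset.sum_add_distrib]
    refine Finset.sum_eq_zero fun α _ => ?_
    rw [← Finset.sum_add_distrib]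
    refine Finset.sum_eq_zero fun r _ => ?_
    have h1 := H.metric x hx k α r
    have h2 := minkowski_mul_self r
    have h3 := minkowski_mul_self α
    linear_combination curvatureLow e Γ α m r β x * minkowski r r * minkowski α α * h1
      - curvatureLow e Γ α m r β x * minkowski α α * Γ x r k α * h2
      - curvatureLow e Γ α m r β x * minkowski r r * Γ x α k r * h3
  have hs1 : ∑ r, Γ x r k m * ∑ α, minkowski α α * curvatureLow e Γ α r α β x
      = ∑ α, ∑ r, minkowski α α * (Γ x r k m * curvatureLow e Γ α r α β x) := by
    simp only [Finset.mul_sum]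
    rw [Finset.sum_comm]
    exact Finset.sum_congr rfl fun α _ => Finset.sum_congr rfl fun r _ => by ring
  have hs2 : ∑ r, Γ x r k β * ∑ α, minkowski α α * curvatureLow e Γ α m α r x
      = ∑ α, ∑ r, minkowski α α * (Γ x r k β * curvatureLow e Γ α m α r x) := by
    simp only [Finset.mul_sum]
    rw [Finset.sum_comm]
    exact Finset.sum_congr rfl fun α _ => Finset.sum_congr rfl fun r _ => by ring
  rw [covDerivTwo, hp]
  simp only [covDerivFour, hr, mul_sub, Finset.sum_sub_distrib,
    Finset.sum_add_distrib, mul_add, Finset.mul_sum] at h0 hs1 hs2 ⊢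
  linarith

/-- Trace the cyclic identity over the index of differentiation and the third index. The two other
terms become derivatives of the Ricci tensor, and pair symmetry places the divergence on the first
pair. -/
theorem contracted_bianchi (H : IsLeviCivita Ω θ e Γ) (hΩ : IsOpen Ω) (hx : x ∈ Ω)
    (i p q : Fin 4) :
    ∑ α, minkowski α α *
        covDerivFour e Γ (fun y l m α β => curvatureLow e Γ l m α β y) α α i p q x
      = covDerivTwo e Γ (fun y => ricci e Γ y) p q i x
        - covDerivTwo e Γ (fun y => ricci e Γ y) q p i x := by
  rw [H.covDeriv_ricci hΩ hx, H.covDeriv_ricci hΩ hx, ← Finset.sum_sub_distrib]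
  refine Finset.sum_congr rfl fun α _ => ?_
  have h1 := H.second_bianchi hΩ hx α p q α i
  have h2 := H.covDeriv_pair_symm hΩ hx α α i p q
  have h3 := covDerivFour_antisymm_left hΩ hx e Γ
    (T := fun y l m α β => curvatureLow e Γ l m α β y)
    (fun y _ l m α β => curvatureLow_antisymm_left e Γ l m α β y) p α q α i
  linear_combination minkowski α α * (h1 + h2 - h3)

end IsLeviCivita

/-! ### The Cattaneo-Ferrarese frame -/

/-- The domain is a general normed space because the frame is used both as a field on spacetime and
as a function of point and state. Smoothness of the inverse matrix is Cramer's rule. -/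
theorem contDiffOn_cfFrame {E : Type*} [NormedAddCommGroup E] [NormedSpace ℝ E] {s : Set E}
    {U : E → ℝ} {a : E → Fin 3 → Fin 3 → ℝ} {b : E → Fin 3 → ℝ}
    (hU : ContDiffOn ℝ ∞ U s) (hU0 : ∀ y ∈ s, U y ≠ 0)
    (ha : ∀ i j, ContDiffOn ℝ ∞ (fun y => a y i j) s)
    (ha0 : ∀ y ∈ s, (Matrix.of (a y)).det ≠ 0) (hb : ∀ i, ContDiffOn ℝ ∞ (fun y => b y i) s)
    (α ν : Fin 4) : ContDiffOn ℝ ∞ (fun y => cfFrame (U y) (a y) (b y) α ν) s := by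
  have hUi : ContDiffOn ℝ ∞ (fun y => (U y)⁻¹) s := hU.inv hU0
  have hdet : ContDiffOn ℝ ∞ (fun y => (Matrix.of (a y)).det) s := by
    simp only [Matrix.det_fin_three, Matrix.of_apply]
    fun_prop
  have hadj (i j : Fin 3) : ContDiffOn ℝ ∞ (fun y => (Matrix.of (a y)).adjugate i j) s := by
    simp only [Matrix.adjugate_fin_three, Matrix.of_apply]
    fin_cases i <;> fin_cases j <;> simp <;> fun_prop
  have hA (i j : Fin 3) : ContDiffOn ℝ ∞ (fun y => (Matrix.of (a y))⁻¹ i j) s := by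
    simp only [Matrix.inv_def, Ring.inverse_eq_inv', Matrix.smul_apply, smul_eq_mul]
    exact (hdet.inv ha0).mul (hadj i j)
  refine Fin.cases ?_ (fun i => ?_) α <;> refine Fin.cases ?_ (fun j => ?_) ν
  · exact hUi
  · exact contDiffOn_const
  · exact (ContDiffOn.sum fun j _ => (hA j i).mul (hUi.mul (hb j))).neg
  · exact hA j i

theorem cfCoframe_dual {U : ℝ} (hU : U ≠ 0) {a : Fin 3 → Fin 3 → ℝ}
    (ha : (Matrix.of a).det ≠ 0) (b : Fin 3 → ℝ) (α β : Fin 4) :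
    ∑ ν, cfCoframe U a b α ν * cfFrame U a b β ν = if α = β then 1 else 0 := by
  have hA : Matrix.of a * (Matrix.of a)⁻¹ = 1 := Matrix.mul_nonsing_inv _ (isUnit_iff_ne_zero.2 ha)
  refine Fin.cases ?_ (fun i => ?_) α <;> refine Fin.cases ?_ (fun j => ?_) β
  · simp [Fin.sum_univ_succ, cfCoframe, cfFrame, hU]
  · rw [Fin.sum_univ_succ]
    simp only [cfCoframe, cfFrame, Fin.cases_zero, Fin.cases_succ, (Fin.succ_ne_zero j).symm,
      if_false, mul_neg, Finset.mul_sum, ← Finset.sum_neg_distrib, ← Finset.sum_add_distrib]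
    refine Finset.sum_eq_zero fun k _ => ?_
    field_simp
    ring
  · simp [Fin.sum_univ_succ, cfCoframe, cfFrame]
  · have := congrFun (congrFun hA i) j
    rw [Matrix.mul_apply] at this
    rw [Fin.sum_univ_succ]
    simpa [cfCoframe, cfFrame, Matrix.one_apply] using this

section CattaneoFerrarese

variable {Ω : Set Spacetime} {U : Spacetime → ℝ} {a : Spacetime → Fin 3 → Fin 3 → ℝ}
  {b : Spacetime → Fin 3 → ℝ}

theorem isDualFrame_cf (hU : ContDiffOn ℝ ∞ U Ω) (hU0 : ∀ y ∈ Ω, U y ≠ 0)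
    (ha : ContDiffOn ℝ ∞ a Ω) (ha0 : ∀ y ∈ Ω, (Matrix.of (a y)).det ≠ 0)
    (hb : ContDiffOn ℝ ∞ b Ω) :
    IsDualFrame Ω (fun x => cfCoframe (U x) (a x) (b x)) (cfFrameField U a b) := by
  have ha' (i j : Fin 3) : ContDiffOn ℝ ∞ (fun y => a y i j) Ω :=
    contDiffOn_pi.1 (contDiffOn_pi.1 ha i) j
  have hb' (i : Fin 3) : ContDiffOn ℝ ∞ (fun y => b y i) Ω := contDiffOn_pi.1 hb i
  refine ⟨fun α ν => ?_, contDiffOn_cfFrame hU hU0 ha' ha0 hb', fun y hy α β =>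
    cfCoframe_dual (hU0 y hy) (ha0 y hy) (b y) α β⟩
  refine Fin.cases ?_ (fun i => ?_) α <;> refine Fin.cases ?_ (fun j => ?_) ν
  · exact hU
  · exact hb' j
  · exact contDiffOn_const
  · exact ha' i j

/-- Koszul's formula in an orthonormal frame. Antisymmetry of c in its lower pair makes the
combination antisymmetric in its last two indices, which is metricity, with c as its antisymmetric
part in the first two, which is zero torsion. -/
theorem isLeviCivita_leviCivita {θ e : Spacetime → Fin 4 → Fin 4 → ℝ} (hΩ : IsOpen Ω)
    (H : IsDualFrame Ω θ e) : IsLeviCivita Ω θ e (leviCivita θ e) where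
  toIsDualFrame := H
  smooth γ α β := by
    have h (β γ l : Fin 4) : ContDiffOn ℝ ∞ (structureCoeffLow θ e β γ l) Ω :=
      contDiffOn_const.mul (H.smooth_structureCoeff hΩ l β γ)
    exact contDiffOn_const.mul
      (contDiffOn_const.mul (((h α β γ).sub (h α γ β)).sub (h β γ α)))
  metric y _ α β γ := by
    simp only [leviCivita, ← mul_assoc, minkowski_mul_self, one_mul, leviCivitaLow,
      structureCoeffLow, IsDualFrame.structureCoeff_antisymm α β γ]
    ring
  torsion y _ γ α β := by
    have h := minkowski_mul_self γ
    simp only [leviCivita, leviCivitaLow, structureCoeffLow,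
      IsDualFrame.structureCoeff_antisymm γ α β]
    linear_combination structureCoeff θ e γ α β y * h

theorem isLeviCivita_cf (hΩ : IsOpen Ω) (hU : ContDiffOn ℝ ∞ U Ω) (hU0 : ∀ y ∈ Ω, U y ≠ 0)
    (ha : ContDiffOn ℝ ∞ a Ω) (ha0 : ∀ y ∈ Ω, (Matrix.of (a y)).det ≠ 0)
    (hb : ContDiffOn ℝ ∞ b Ω) :
    IsLeviCivita Ω (fun x => cfCoframe (U x) (a x) (b x)) (cfFrameField U a b)
      (cfConnection U a b) :=
  isLeviCivita_leviCivita hΩ (isDualFrame_cf hU hU0 ha ha0 hb)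

end CattaneoFerrarese

/-! ### Algebra of the unknowns -/

theorem bivector_antisymm (P : Fin 6) (α β : Fin 4) : bivector P β α = -bivector P α β := by
  simp only [bivector]
  ring

theorem bivector_pairIdx (P Q : Fin 6) :
    bivector P (pairIdx Q).1 (pairIdx Q).2 = if P = Q then 1 else 0 := by
  fin_cases P <;> fin_cases Q <;> simp [bivector, pairIdx]

/-- The six bivectors form a basis of antisymmetric tensors; this rebuilds a tensor from the list of
components stored in a state. -/
theorem sum_bivector {t : Fin 4 → Fin 4 → ℝ} (ht : ∀ α β, t β α = -t α β) (α β : Fin 4) :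
    ∑ P, bivector P α β * t (pairIdx P).1 (pairIdx P).2 = t α β := by
  have hd (α : Fin 4) : t α α = 0 := by linarith [ht α α]
  fin_cases α <;> fin_cases β <;>
    simp [bivector, pairIdx, Fin.sum_univ_succ, hd, ← ht]

theorem minkowski_symm (α β : Fin 4) : minkowski α β = minkowski β α := by
  simp only [minkowski, Matrix.diagonal_apply, eq_comm (a := α)]
  split_ifs with h
  · rw [h]
  · rfl

theorem minkowski_zero_zero : minkowski 0 0 = -1 := by simp [minkowski]

theorem minkowski_succ (i : Fin 3) (α : Fin 4) :
    minkowski i.succ α = if i.succ = α then 1 else 0 := by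
  simp only [minkowski, Matrix.diagonal_apply]
  fin_cases i <;> simp

theorem curvShift_antisymm_left (r : Fin 4 → Fin 4 → ℝ) (α β l m : Fin 4) :
    curvShift r β α l m = -curvShift r α β l m := by
  simp only [curvShift, or_left_comm (a := β = 0) (b := α = 0)]
  split_ifs
  · simp
  · ring

theorem curvShift_antisymm_right (r : Fin 4 → Fin 4 → ℝ) (α β l m : Fin 4) :
    curvShift r α β m l = -curvShift r α β l m := by
  simp only [curvShift, or_comm (a := m = 0) (b := l = 0)]
  split_ifs
  · simp
  · ring

theorem flowCovec_succ (i : Fin 3) : flowCovec i.succ = 0 := by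
  simp [flowCovec, flowVec, minkowski_succ]

theorem dustSource_succ_succ (μ : ℝ) (i j : Fin 3) :
    dustSource μ i.succ j.succ = if i = j then μ / 2 else 0 := by
  simp only [dustSource, flowCovec_succ, minkowski_succ, Fin.succ_inj]
  split_ifs <;> ring

theorem dustSource_zero_succ (μ : ℝ) (i : Fin 3) : dustSource μ 0 i.succ = 0 := by
  rw [dustSource, flowCovec_succ, minkowski_symm, minkowski_succ, if_neg (Fin.succ_ne_zero i)]
  ring

theorem dustSource_symm (μ : ℝ) (α β : Fin 4) : dustSource μ α β = dustSource μ β α := by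
  rw [dustSource, dustSource, minkowski_symm]
  ring

theorem dustSource_zero_zero (μ : ℝ) : dustSource μ 0 0 = μ / 2 := by
  simp [dustSource, flowCovec, flowVec, minkowski_zero_zero, Fin.sum_univ_succ]
  ring

theorem curvShift_dustSource_of_zero (μ : ℝ) {α β l m : Fin 4}
    (h : α = 0 ∨ β = 0 ∨ l = 0 ∨ m = 0) : curvShift (dustSource μ) α β l m = 0 :=
  if_pos h

/-- Here ρ_{ij} = (μ/2) δ_{ij} and tr ρ = -μ/2 + 3μ/2 = μ. The four Ricci terms give twice the
isotropic tensor below, and the trace term takes half of it away. -/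
theorem curvShift_dustSource_succ (μ : ℝ) (k i h j : Fin 3) :
    curvShift (dustSource μ) k.succ i.succ h.succ j.succ
      = μ / 2 * ((if k = j then 1 else 0) * (if i = h then 1 else 0)
        - (if k = h then 1 else 0) * (if i = j then 1 else 0)) := by
  have htr : ∑ α, minkowski α α * dustSource μ α α = μ := by
    rw [Fin.sum_univ_succ, minkowski_zero_zero, dustSource_zero_zero]
    simp only [minkowski_succ, dustSource_succ_succ, if_true, Finset.sum_const, Finset.card_univ,
      Fintype.card_fin]
    simp only [nsmul_eq_mul]
    push_cast
    ring
  have hite (p q : Fin 3) : (if p = q then μ / 2 else 0) = μ / 2 * if p = q then 1 else 0 := by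
    split_ifs <;> ring
  rw [curvShift, if_neg (by simp), htr]
  simp only [minkowski_succ, dustSource_succ_succ, Fin.succ_inj, hite]
  ring

/-- Linearity in μ: a derivative of the shift is a constant times the same derivative of μ. -/
theorem curvShift_dustSource_eq_mul (μ : ℝ) (α β l m : Fin 4) :
    curvShift (dustSource μ) α β l m = μ * curvShift (dustSource 1) α β l m := by
  have h (α β : Fin 4) : dustSource μ α β = μ * dustSource 1 α β := by
    simp only [dustSource]
    ring
  simp only [curvShift, h, mul_left_comm _ μ, ← Finset.mul_sum]
  split_ifs
  · simp
  · ring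

namespace EDFFState

theorem modifiedCurvature_antisymm_left (w : EDFFState) (α β l m : Fin 4) :
    w.modifiedCurvature β α l m = -w.modifiedCurvature α β l m := by
  simp only [modifiedCurvature, bivector_antisymm _ α β, neg_mul, Finset.sum_neg_distrib]

theorem modifiedCurvature_antisymm_right (w : EDFFState) (α β l m : Fin 4) :
    w.modifiedCurvature α β m l = -w.modifiedCurvature α β l m := by
  simp only [modifiedCurvature, bivector_antisymm _ l m, neg_mul, mul_neg,
    Finset.sum_neg_distrib]

theorem modifiedCurvature_pairIdx (w : EDFFState) (P Q : Fin 6) :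
    w.modifiedCurvature (pairIdx P).1 (pairIdx P).2 (pairIdx Q).1 (pairIdx Q).2 = w.curv P Q := by
  simp [modifiedCurvature, bivector_pairIdx]

theorem riemann_antisymm_left (w : EDFFState) (α β l m : Fin 4) :
    w.riemann β α l m = -w.riemann α β l m := by
  rw [riemann, riemann, modifiedCurvature_antisymm_left, curvShift_antisymm_left]
  ring

theorem riemann_antisymm_right (w : EDFFState) (α β l m : Fin 4) :
    w.riemann α β m l = -w.riemann α β l m := by
  rw [riemann, riemann, modifiedCurvature_antisymm_right, curvShift_antisymm_right]
  ring

theorem connectionLow_succ (f : Fin 3 → Fin 3 → ℝ) (w : EDFFState) (i : Fin 3) (β γ : Fin 4) :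
    connectionLow f w i.succ β γ = ∑ Q, bivector Q β γ * w.conn i Q := rfl

theorem connectionLow_antisymm {f : Fin 3 → Fin 3 → ℝ} (hf : ∀ i j, f j i = -f i j)
    (w : EDFFState) (α β γ : Fin 4) :
    connectionLow f w α γ β = -connectionLow f w α β γ := by
  refine Fin.cases ?_ (fun i => ?_) α
  · refine Fin.cases ?_ (fun i => ?_) β <;> refine Fin.cases ?_ (fun j => ?_) γ
    · simp [connectionLow]
    · simp [connectionLow]
    · simp [connectionLow]
    · exact hf i j
  · simp only [connectionLow_succ, bivector_antisymm _ β γ, neg_mul, Finset.sum_neg_distrib]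

/-- With f antisymmetric, even an unknown connection is metric, so its curvature is antisymmetric in
the second pair before any equation is imposed. -/
theorem connection_metric {f : Fin 3 → Fin 3 → ℝ} (hf : ∀ i j, f j i = -f i j)
    (w : EDFFState) (α β γ : Fin 4) :
    minkowski γ γ * w.connection f γ α β = -(minkowski β β * w.connection f β α γ) := by
  rw [connection, connection, ← mul_assoc, ← mul_assoc, minkowski_mul_self, minkowski_mul_self,
    connectionLow_antisymm hf w α γ β]
  ring

end EDFFState

/-! ### Solutions of the Einstein-dust equations -/

namespace IsEinsteinDust

variable {Ω : Set Spacetime} {U : Spacetime → ℝ} {a : Spacetime → Fin 3 → Fin 3 → ℝ}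
  {b : Spacetime → Fin 3 → ℝ} {μ : Spacetime → ℝ} {θ : Spacetime → Fin 4 → Fin 4 → ℝ}
  {x : Spacetime}

theorem ricci_eq (hE : IsEinsteinDust Ω U a b μ) (hx : x ∈ Ω) :
    ricci (cfFrameField U a b) (cfConnection U a b) x = dustSource (μ x) := by
  ext α β
  exact hE.einstein x hx α β

theorem connection_zero_zero (hE : IsEinsteinDust Ω U a b μ) (hx : x ∈ Ω) (γ : Fin 4) :
    cfConnection U a b x γ 0 0 = 0 := by
  simpa [flowVec, covDerivVec, pfaff_const, Pi.single_apply] using hE.geodesic x hx γ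

/-- The Einstein equations turn the Ricci tensor in the shift into ρ; the tensor is then
antisymmetric in each pair and is recovered from its 36 components by `sum_bivector`, applied to
each pair. -/
theorem modifiedCurvature_eq
    (H : IsLeviCivita Ω θ (cfFrameField U a b) (cfConnection U a b)) (hΩ : IsOpen Ω)
    (hE : IsEinsteinDust Ω U a b μ) (hx : x ∈ Ω) :
    (edffUnknowns U a b μ x).modifiedCurvature = fun α β l m =>
      curvatureLow (cfFrameField U a b) (cfConnection U a b) α β l m x
        + curvShift (dustSource (μ x)) α β l m := by
  funext α β l m
  set T : Fin 4 → Fin 4 → Fin 4 → Fin 4 → ℝ := fun α β l m =>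
    curvatureLow (cfFrameField U a b) (cfConnection U a b) α β l m x
      + curvShift (dustSource (μ x)) α β l m with hT
  have hl (α β l m : Fin 4) : T β α l m = -T α β l m := by
    simp only [hT, curvatureLow_antisymm_left _ _ α β, curvShift_antisymm_left _ α β]
    ring
  have hr (α β l m : Fin 4) : T α β m l = -T α β l m := by
    simp only [hT, H.curvatureLow_antisymm hΩ hx α β l m, curvShift_antisymm_right _ α β l m]
    ring
  have hc (P Q : Fin 6) : (edffUnknowns U a b μ x).curv P Q
      = T (pairIdx P).1 (pairIdx P).2 (pairIdx Q).1 (pairIdx Q).2 := by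
    simp [EDFFState.curv, edffUnknowns, hT, hE.ricci_eq hx]
  have h1 (P : Fin 6) : ∑ Q, bivector P α β * bivector Q l m *
      T (pairIdx P).1 (pairIdx P).2 (pairIdx Q).1 (pairIdx Q).2
      = bivector P α β * T (pairIdx P).1 (pairIdx P).2 l m := by
    rw [← sum_bivector (hr (pairIdx P).1 (pairIdx P).2) l m, Finset.mul_sum]
    exact Finset.sum_congr rfl fun Q _ => mul_assoc _ _ _
  simp only [EDFFState.modifiedCurvature, hc, h1]
  exact sum_bivector (t := fun α β => T α β l m) (fun α β => hl α β l m) α β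

theorem riemann_eq
    (H : IsLeviCivita Ω θ (cfFrameField U a b) (cfConnection U a b)) (hΩ : IsOpen Ω)
    (hE : IsEinsteinDust Ω U a b μ) (hx : x ∈ Ω) :
    (edffUnknowns U a b μ x).riemann = fun α β l m =>
      curvatureLow (cfFrameField U a b) (cfConnection U a b) α β l m x := by
  funext α β l m
  rw [EDFFState.riemann, hE.modifiedCurvature_eq H hΩ hx]
  exact add_sub_cancel_right _ _

theorem edffConnection_eq {f : Spacetime → Fin 3 → Fin 3 → ℝ}
    (H : IsLeviCivita Ω θ (cfFrameField U a b) (cfConnection U a b))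
    (hE : IsEinsteinDust Ω U a b μ)
    (hf : ∀ x ∈ Ω, ∀ i j : Fin 3, cfConnection U a b x j.succ 0 i.succ = f x i j)
    (hx : x ∈ Ω) : edffConnection f (edffUnknowns U a b μ) x = cfConnection U a b x := by
  funext γ α β
  -- The component ω^0_{0i} vanishes too: metricity ties it to ω^i_{00}, which is zero by the
  -- geodesic equation.
  have h0 (i : Fin 3) : cfConnection U a b x 0 0 i.succ = 0 := by
    have := H.metric x hx 0 i.succ 0
    rw [hE.connection_zero_zero hx, minkowski_zero_zero] at this
    linarith
  suffices h : EDFFState.connectionLow (f x) (edffUnknowns U a b μ x) α β γ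
      = minkowski γ γ * cfConnection U a b x γ α β by
    rw [edffConnection, EDFFState.connection, h, ← mul_assoc, minkowski_mul_self, one_mul]
  refine Fin.cases ?_ (fun i => ?_) α
  · refine Fin.cases ?_ (fun i => ?_) β
    · rw [hE.connection_zero_zero hx]
      simp [EDFFState.connectionLow]
    · refine Fin.cases ?_ (fun j => ?_) γ
      · simp [EDFFState.connectionLow, h0]
      · rw [hf x hx]
        simp [EDFFState.connectionLow, minkowski_succ]
  · rw [EDFFState.connectionLow_succ]
    exact sum_bivector (t := fun β γ => minkowski γ γ * cfConnection U a b x γ i.succ β)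
      (fun β γ => H.metric x hx i.succ γ β) β γ

end IsEinsteinDust

/-- The tensor `F_{ij,hk} - R_{ij,hk}` of a dust source is `μ` times a spatially isotropic tensor:
its spatial divergence involves only the derivatives of `μ`. -/
theorem sum_covDerivFour_curvShift_dustSource (e : Spacetime → Fin 4 → Fin 4 → ℝ)
    {Γ : Spacetime → Fin 4 → Fin 4 → Fin 4 → ℝ} {x : Spacetime}
    (hΓ : ∀ s i j : Fin 3, Γ x j.succ s.succ i.succ = -Γ x i.succ s.succ j.succ)
    (μ : Spacetime → ℝ) (i h j : Fin 3) :
    ∑ k : Fin 3, covDerivFour e Γ (fun y => curvShift (dustSource (μ y)))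
        k.succ k.succ i.succ h.succ j.succ x
      = (if i = h then pfaff e j.succ μ x / 2 else 0)
        - (if i = j then pfaff e h.succ μ x / 2 else 0) := by
  have hp (s : Fin 4) (α β l m : Fin 4) :
      pfaff e s (fun y => curvShift (dustSource (μ y)) α β l m) x
        = curvShift (dustSource 1) α β l m * pfaff e s μ x := by
    simp only [curvShift_dustSource_eq_mul (μ _), mul_comm (μ _), pfaff_const_mul]
  -- The shift vanishes on any index 0, so only spatial connection coefficients act on it. They are
  -- infinitesimal rotations and leave an isotropic tensor unchanged.
  have hk (k : Fin 3) : covDerivFour e Γ (fun y => curvShift (dustSource (μ y)))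
      k.succ k.succ i.succ h.succ j.succ x
      = curvShift (dustSource 1) k.succ i.succ h.succ j.succ * pfaff e k.succ μ x := by
    rw [covDerivFour, hp, sub_eq_self, Fin.sum_univ_succ]
    simp only [curvShift_dustSource_of_zero, true_or, or_true, mul_zero, add_zero, zero_add,
      curvShift_dustSource_succ, Finset.sum_add_distrib]
    have hμ (s i j : Fin 3) : Γ x j.succ s.succ i.succ * (μ x / 2)
        = -(Γ x i.succ s.succ j.succ * (μ x / 2)) := by
      rw [hΓ s i j, neg_mul]
    have e1 := hμ k k j
    have e2 := hμ k k h
    have e3 := hμ k i j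
    have e4 := hμ k i h
    simp only [mul_sub, mul_ite, mul_one, mul_zero, Finset.sum_sub_distrib,
      Finset.sum_ite_irrel, Finset.sum_const_zero,
      Finset.sum_ite_eq, Finset.sum_ite_eq', Finset.mem_univ, if_true]
    split_ifs <;> subst_vars <;> first | contradiction | linarith
  simp only [hk, curvShift_dustSource_succ]
  simp only [mul_sub, sub_mul, mul_ite, ite_mul, mul_one, mul_zero, zero_mul,
      Finset.sum_sub_distrib, Finset.sum_ite_irrel, Finset.sum_const_zero,
      Finset.sum_ite_eq', Finset.mem_univ, if_true]
  split_ifs <;> ring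

/-! ### Torsion on the pairs (e_k, e_0) and the frame coefficients -/

section CattaneoFerrarese

variable {Ω : Set Spacetime} {U : Spacetime → ℝ} {a : Spacetime → Fin 3 → Fin 3 → ℝ}
  {b : Spacetime → Fin 3 → ℝ} {x : Spacetime}

theorem pfaff_cfFrameField_zero (g : Spacetime → ℝ) :
    pfaff (cfFrameField U a b) 0 g x = (U x)⁻¹ * partialDeriv 0 g x := by
  simp [pfaff, cfFrameField, cfFrame, Fin.sum_univ_succ]

/-- As e_0 is proportional to ∂/∂x⁰, antisymmetry of dθ removes the time component of e_k, and with
it the coefficients b in the frame. -/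
theorem structureCoeff_cf_time (α : Fin 4) (k : Fin 3) :
    structureCoeff (fun x => cfCoframe (U x) (a x) (b x)) (cfFrameField U a b) α k.succ 0 x
      = (U x)⁻¹ * ∑ l : Fin 3, (Matrix.of (a x))⁻¹ l k *
        (partialDeriv 0 (fun y => cfCoframe (U y) (a y) (b y) α l.succ) x
          - partialDeriv l.succ (fun y => cfCoframe (U y) (a y) (b y) α 0) x) := by
  have h0 : cfFrameField U a b x 0 0 = (U x)⁻¹ := rfl
  have hs (l : Fin 3) : cfFrameField U a b x 0 l.succ = 0 := rfl
  have hk (l : Fin 3) : cfFrameField U a b x k.succ l.succ = (Matrix.of (a x))⁻¹ l k := rfl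
  rw [structureCoeff, Fin.sum_univ_succ]
  simp only [Fin.sum_univ_succ (n := 3), h0, hs, hk, sub_self, mul_zero, zero_mul,
    Finset.sum_const_zero, add_zero, zero_add, ← Finset.sum_neg_distrib, Finset.mul_sum]
  exact Finset.sum_congr rfl fun l _ => by ring

/-- Used to solve the torsion equations, which are contracted with a⁻¹, for the time derivatives of
`a` and `b`. -/
theorem sum_mul_inv_mul {A : Fin 3 → Fin 3 → ℝ} (hA : (Matrix.of A).det ≠ 0) (u : Fin 3 → ℝ)
    (j : Fin 3) : ∑ k, A k j * ∑ l, (Matrix.of A)⁻¹ l k * u l = u j := by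
  have h : (Matrix.of A)⁻¹ * Matrix.of A = 1 :=
    Matrix.nonsing_inv_mul _ (isUnit_iff_ne_zero.2 hA)
  have hc := congrArg (fun M => Matrix.vecMul u M j) h
  simp only [← Matrix.vecMul_vecMul, Matrix.vecMul_one] at hc
  rw [← hc]
  simp only [Matrix.vecMul, dotProduct, Matrix.of_apply]
  refine Finset.sum_congr rfl fun k _ => ?_
  rw [mul_comm]
  exact congrArg (· * A k j) (Finset.sum_congr rfl fun l _ => mul_comm _ _)

end CattaneoFerrarese

namespace IsEinsteinDust

variable {Ω : Set Spacetime} {U : Spacetime → ℝ} {a : Spacetime → Fin 3 → Fin 3 → ℝ}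
  {b : Spacetime → Fin 3 → ℝ} {μ : Spacetime → ℝ} {f : Spacetime → Fin 3 → Fin 3 → ℝ}

/-- The unknowns built from a solution of the Einstein-dust equations satisfy the EDFF system. -/
theorem edffEquations (hE : IsEinsteinDust Ω U a b μ) (hΩ : IsOpen Ω)
    (hU0 : ∀ y ∈ Ω, U y ≠ 0) (ha0 : ∀ y ∈ Ω, (Matrix.of (a y)).det ≠ 0)
    (hμ : ContDiffOn ℝ ∞ μ Ω)
    (H : IsLeviCivita Ω (fun x => cfCoframe (U x) (a x) (b x)) (cfFrameField U a b)
      (cfConnection U a b))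
    (hf : ∀ x ∈ Ω, ∀ i j : Fin 3, cfConnection U a b x j.succ 0 i.succ = f x i j) :
    EDFFEquations Ω U f (edffUnknowns U a b μ) := by
  set e := cfFrameField U a b with he
  set Γ := cfConnection U a b with hΓ
  set v := edffUnknowns U a b μ
  have hfr : edffFrame U v = e := rfl
  have hcon (x : Spacetime) (hx : x ∈ Ω) : edffConnection f v x = Γ x :=
    hE.edffConnection_eq H hf hx
  have hR (x : Spacetime) (hx : x ∈ Ω) (s α β l m : Fin 4) :
      covDerivFour e (edffConnection f v) (fun y => (v y).riemann) s α β l m x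
        = covDerivFour e Γ (fun y l m α β => curvatureLow e Γ l m α β y) s α β l m x :=
    covDerivFour_congr hΩ hx e (hcon x hx) (fun y hy => hE.riemann_eq H hΩ hy) s α β l m
  have hC (x : Spacetime) (hx : x ∈ Ω) (s α β l m : Fin 4) :
      covDerivFour e (edffConnection f v) (fun y => curvShift (dustSource (v y).mu)) s α β l m x
        = covDerivFour e Γ (fun y => curvShift (dustSource (μ y))) s α β l m x :=
    covDerivFour_congr hΩ hx e (hcon x hx) (fun _ _ => rfl) s α β l m
  have hF (x : Spacetime) (hx : x ∈ Ω) (s α β l m : Fin 4) :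
      covDerivFour e (edffConnection f v) (fun y => (v y).modifiedCurvature) s α β l m x
        = covDerivFour e Γ (fun y l m α β => curvatureLow e Γ l m α β y) s α β l m x
          + covDerivFour e Γ (fun y => curvShift (dustSource (μ y))) s α β l m x := by
    rw [covDerivFour_congr hΩ hx e (hcon x hx)
      (fun y hy => hE.modifiedCurvature_eq H hΩ hy) s α β l m]
    refine covDerivFour_add ((H.smooth_curvatureLow hΩ α β l m).diffAt hΩ hx) ?_ s
    simp only [curvShift_dustSource_eq_mul (μ _)]
    exact (hμ.diffAt hΩ hx).mul_const _
  have hρ (x : Spacetime) (hx : x ∈ Ω) (s α β : Fin 4) :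
      covDerivTwo e (edffConnection f v) (fun y => dustSource (v y).mu) s α β x
        = covDerivTwo e Γ (fun y => ricci e Γ y) s α β x :=
    covDerivTwo_congr hΩ hx e (hcon x hx) (fun y hy => (hE.ricci_eq hy).symm) s α β
  have hanti (x : Spacetime) (hx : x ∈ Ω) (s α β l m : Fin 4) :
      covDerivFour e Γ (fun y l m α β => curvatureLow e Γ l m α β y) s β α l m x
        = -covDerivFour e Γ (fun y l m α β => curvatureLow e Γ l m α β y) s α β l m x :=
    covDerivFour_antisymm_left hΩ hx e Γ
      (T := fun y l m α β => curvatureLow e Γ l m α β y)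
      (fun y _ α β l m => curvatureLow_antisymm_left e Γ α β l m y) s α β l m
  have hdiv (x : Spacetime) (hx : x ∈ Ω) (i p q : Fin 4) :
      -covDerivFour e Γ (fun y l m α β => curvatureLow e Γ l m α β y) 0 0 i p q x
        + ∑ h : Fin 3,
          covDerivFour e Γ (fun y l m α β => curvatureLow e Γ l m α β y) h.succ h.succ i p q x
        = covDerivTwo e Γ (fun y => ricci e Γ y) p q i x
          - covDerivTwo e Γ (fun y => ricci e Γ y) q p i x := by
    rw [← H.contracted_bianchi hΩ hx i p q, Fin.sum_univ_succ (n := 3), minkowski_zero_zero]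
    simp only [minkowski_succ, if_true, one_mul, neg_mul]
  have hΓs (x : Spacetime) (hx : x ∈ Ω) (s i j : Fin 3) :
      Γ x j.succ s.succ i.succ = -Γ x i.succ s.succ j.succ := by
    simpa [minkowski_succ] using H.metric x hx s.succ i.succ j.succ
  have hΓ00 (x : Spacetime) (hx : x ∈ Ω) (γ : Fin 4) : Γ x γ 0 0 = 0 :=
    hE.connection_zero_zero hx γ
  have hΓ0 (x : Spacetime) (hx : x ∈ Ω) (i : Fin 3) : Γ x 0 0 i.succ = 0 := by
    have := H.metric x hx 0 i.succ 0
    rw [hΓ00 x hx, minkowski_zero_zero] at this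
    linarith
  have hcurv (x : Spacetime) (hx : x ∈ Ω) (l m α β : Fin 4) :
      curvatureLow e (edffConnection f v) l m α β x = curvatureLow e Γ l m α β x := by
    simp only [curvatureLow, curvature, hcon x hx,
      pfaff_congr hΩ hx (fun y hy => by rw [hcon y hy] :
        ∀ y ∈ Ω, edffConnection f v y α m β = Γ y α m β),
      pfaff_congr hΩ hx (fun y hy => by rw [hcon y hy] :
        ∀ y ∈ Ω, edffConnection f v y α l β = Γ y α l β)]
  refine ⟨fun x hx h k j => ?_, fun x hx i j => ?_, fun x hx i j h k => ?_,
    fun x hx i h j => ?_, fun x hx h i j => ?_, fun x hx h i => ?_, fun x hx i j => ?_,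
    fun x hx i => ?_, fun x hx => ?_⟩
  · rw [hfr, hR x hx, hR x hx, hR x hx]
    linarith [H.second_bianchi hΩ hx 0 h.succ k.succ 0 j.succ,
      hanti x hx h.succ 0 k.succ 0 j.succ]
  · simp only [hfr, hR x hx, hρ x hx]
    exact hdiv x hx i.succ 0 j.succ
  · rw [hfr, hR x hx, hR x hx, hF x hx, hC x hx]
    linarith [H.second_bianchi hΩ hx 0 i.succ j.succ h.succ k.succ,
      hanti x hx i.succ 0 j.succ h.succ k.succ]
  · simp only [hfr, hR x hx, hF x hx, Finset.sum_add_distrib]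
    -- The space derivatives of μ cancel here: ∇_h ρ_{ji} - ∇_j ρ_{hi} from the contracted Bianchi
    -- identity is the opposite of the divergence of C.
    rw [sum_covDerivFour_curvShift_dustSource e (hΓs x hx) μ i h j, ← add_assoc, hdiv x hx,
      ← hρ x hx, ← hρ x hx]
    have hc (h j i : Fin 3) : covDerivTwo e (edffConnection f v)
        (fun y => dustSource (v y).mu) h.succ j.succ i.succ x
        = if i = j then pfaff e h.succ μ x / 2 else 0 := by
      have hp : pfaff e h.succ (fun y => dustSource (v y).mu j.succ i.succ) x
          = if i = j then pfaff e h.succ μ x / 2 else 0 := by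
        simp only [dustSource_succ_succ, eq_comm (a := j)]
        split_ifs
        · have h2 : (fun y => (v y).mu / 2) = fun y => (1 / 2) * μ y := by
            funext y
            have : (v y).mu = μ y := rfl
            rw [this]
            ring
          rw [h2, pfaff_const_mul]
          ring
        · exact pfaff_const _ _ _
      -- The spatial block of ρ is a multiple of δ and ρ_{0i} = 0, so the antisymmetric spatial
      -- connection coefficients contribute nothing.
      rw [covDerivTwo, hp, sub_eq_self, Fin.sum_univ_succ]
      simp only [dustSource_zero_succ, dustSource_symm _ j.succ 0, dustSource_succ_succ, hcon x hx,
        mul_ite, mul_zero, Finset.sum_add_distrib, Finset.sum_ite_eq, Finset.sum_ite_eq',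
        Finset.mem_univ, if_true, hΓs x hx h j i]
      ring
    rw [hc, hc]
    simp only [eq_comm (a := i)]
    ring
  · rw [hfr, hcurv x hx, hE.riemann_eq H hΩ hx]
  · rw [hfr, hcurv x hx, hE.riemann_eq H hΩ hx]
  · have h1 : (fun y => (v y).a i j) = fun y => a y i j := rfl
    have h2 (k : Fin 3) : (v x).a k j = a x k j := rfl
    have h3 (l : Fin 3) : (fun y => cfCoframe (U y) (a y) (b y) i.succ l.succ)
        = fun y => a y i l := rfl
    have h4 : (fun y => cfCoframe (U y) (a y) (b y) i.succ 0) = fun _ => (0 : ℝ) := rfl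
    -- Since θ^i has no dx⁰ component, the torsion equation for θ^i on (e_k, e_0) contains only
    -- ∂a^i_l/∂x⁰.
    simp only [hfr, hcon x hx, h1, h2, H.torsion x hx, he, structureCoeff_cf_time, h3, h4]
    rw [pfaff_cfFrameField_zero]
    have h5 (l : Fin 3) : partialDeriv l.succ (fun _ => (0 : ℝ)) x = 0 := by simp [partialDeriv]
    simp only [h5, sub_zero, mul_left_comm (a x _ j), ← Finset.mul_sum,
      sum_mul_inv_mul (ha0 x hx) (fun l => partialDeriv 0 (fun y => a y i l) x)]
  · have h1 : (fun y => (v y).b i) = fun y => b y i := rfl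
    have h3 (l : Fin 3) : (fun y => cfCoframe (U y) (a y) (b y) 0 l.succ)
        = fun y => b y l := rfl
    have h4 : (fun y => cfCoframe (U y) (a y) (b y) 0 0) = U := rfl
    -- On (e_k, e_0) the torsion equation for θ⁰ has zero connection side: ω^0_{k0} = 0 by metricity
    -- and ω^0_{0k} = 0 by the geodesic equation. Hence ∂b_l/∂x⁰ = ∂U/∂x^l.
    have h5 (k : Fin 3) : ∑ l, (Matrix.of (a x))⁻¹ l k *
        (partialDeriv 0 (fun y => b y l) x - partialDeriv l.succ U x) = 0 := by
      have h6 : Γ x 0 k.succ 0 = 0 := by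
        have := H.metric x hx k.succ 0 0
        rw [minkowski_zero_zero] at this
        linarith
      have h7 := H.torsion x hx 0 k.succ 0
      rw [hΓ0 x hx, h6, he, structureCoeff_cf_time] at h7
      simp only [h3, h4] at h7
      rcases mul_eq_zero.1 (h7.symm.trans (sub_zero 0)) with h8 | h8
      · exact absurd h8 (inv_ne_zero (hU0 x hx))
      · exact h8
    have h6 := sum_mul_inv_mul (ha0 x hx)
      (fun l => partialDeriv 0 (fun y => b y l) x - partialDeriv l.succ U x) i
    simp only [h5, mul_zero, Finset.sum_const_zero] at h6
    rw [hfr, h1, he, pfaff_cfFrameField_zero, sub_eq_zero.1 h6.symm]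
  · have h1 : (fun y => (v y).mu) = μ := rfl
    have h2 : (v x).mu = μ x := rfl
    have h3 := hE.conservation x hx
    simp only [hfr, h1, h2, hcon x hx]
    -- The divergence of e_0 is ∑ ω^α_{α0}, whose term α = 0 is zero because the flow lines are
    -- geodesics.
    simpa [flowVec, covDerivVec, pfaff_const, Pi.single_apply, Fin.sum_univ_succ,
      hΓ00 x hx, ← he, ← hΓ] using h3

/-- The unknowns built from a solution of the Einstein-dust equations are smooth. -/
theorem contDiffOn_edffUnknowns (hE : IsEinsteinDust Ω U a b μ) (hΩ : IsOpen Ω)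
    (ha : ContDiffOn ℝ ∞ a Ω) (hb : ContDiffOn ℝ ∞ b Ω) (hμ : ContDiffOn ℝ ∞ μ Ω)
    (H : IsLeviCivita Ω (fun x => cfCoframe (U x) (a x) (b x)) (cfFrameField U a b)
      (cfConnection U a b)) :
    ContDiffOn ℝ ∞ (edffUnknowns U a b μ) Ω := by
  rw [contDiffOn_pi]
  rintro (⟨P, Q⟩ | ⟨i, Q⟩ | ⟨i, j⟩ | i | _)
  · have h : ContDiffOn ℝ ∞ (fun y => curvShift (dustSource (μ y))
        (pairIdx P).1 (pairIdx P).2 (pairIdx Q).1 (pairIdx Q).2) Ω := by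
      simp only [curvShift_dustSource_eq_mul (μ _)]
      exact hμ.mul contDiffOn_const
    refine ((H.smooth_curvatureLow hΩ (pairIdx P).1 (pairIdx P).2 (pairIdx Q).1
      (pairIdx Q).2).add h).congr fun y hy => ?_
    simp only [edffUnknowns, Sum.elim_inl, hE.ricci_eq hy]
  · exact contDiffOn_const.mul (H.smooth _ _ _)
  · exact contDiffOn_pi.1 (contDiffOn_pi.1 ha i) j
  · exact contDiffOn_pi.1 hb i
  · exact hμ

end IsEinsteinDust

/-! ### The source of the EDFF system -/

/-- The action of connection coefficients `G` on the components of a 4-tensor, so that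
`∇_σ T = ∂_σ T - G · T`. -/
noncomputable def connActFour (G : Fin 4 → Fin 4 → Fin 4 → ℝ)
    (T : Fin 4 → Fin 4 → Fin 4 → Fin 4 → ℝ) (s α β l m : Fin 4) : ℝ :=
  ∑ r, (G r s α * T r β l m + G r s β * T α r l m + G r s l * T α β r m + G r s m * T α β l r)

/-- The action of connection coefficients `G` on the components of a 2-tensor. -/
noncomputable def connActTwo (G : Fin 4 → Fin 4 → Fin 4 → ℝ) (T : Fin 4 → Fin 4 → ℝ)
    (s α β : Fin 4) : ℝ :=
  ∑ r, (G r s α * T r β + G r s β * T α r)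

namespace EDFFState

/-- The value of `∂_0 μ` prescribed by the conservation of matter. -/
noncomputable def muSource (G : Fin 4 → Fin 4 → Fin 4 → ℝ) (w : EDFFState) : ℝ :=
  -(w.mu * ∑ i : Fin 3, G i.succ i.succ 0)

/-- The source of the equations for the curvature unknowns. -/
noncomputable def curvSource (G : Fin 4 → Fin 4 → Fin 4 → ℝ) (w : EDFFState)
    (α β l m : Fin 4) : ℝ :=
  if α = 0 then
    if l = 0 then
      connActFour G w.riemann 0 α β l m
        - ∑ h : Fin 3, connActFour G w.riemann h.succ h.succ β l m
        - (dustSource (w.muSource G) m β - connActTwo G (dustSource w.mu) 0 m β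
          + connActTwo G (dustSource w.mu) m 0 β)
    else
      connActFour G w.riemann 0 α β l m
        - ∑ h : Fin 3, connActFour G w.modifiedCurvature h.succ h.succ β l m
  else
    curvShift (dustSource (w.muSource G)) α β l m + connActFour G w.riemann 0 α β l m
      + connActFour G w.riemann β 0 α l m - connActFour G w.riemann α 0 β l m

/-- The part of the expression `R_{0i,γβ}` of the curvature through the connection that does not
involve the derivatives of the connection unknowns. -/
noncomputable def curvRest (U : Spacetime → ℝ) (f : Spacetime → Fin 3 → Fin 3 → ℝ)
    (x : Spacetime) (w : EDFFState) (i : Fin 3) (γ β : Fin 4) : ℝ :=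
  minkowski γ γ * (-(∑ ν, cfFrame (U x) w.a w.b i.succ ν *
      partialDeriv ν (fun y => connection (f y) 0 γ 0 β) x)
    - ∑ r, connection (f x) w γ r β
      * (connection (f x) w r 0 i.succ - connection (f x) w r i.succ 0)
    + ∑ r, (connection (f x) w γ 0 r * connection (f x) w r i.succ β
      - connection (f x) w γ i.succ r * connection (f x) w r 0 β))

end EDFFState

/-- The source of the EDFF system. -/
noncomputable def edffSource (U : Spacetime → ℝ) (f : Spacetime → Fin 3 → Fin 3 → ℝ)
    (x : Spacetime) (w : EDFFState) : EDFFState :=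
  Sum.elim
    (fun PQ => w.curvSource (w.connection (f x)) (pairIdx PQ.1).1 (pairIdx PQ.1).2
      (pairIdx PQ.2).1 (pairIdx PQ.2).2)
    (Sum.elim
      (fun iQ => w.riemann 0 iQ.1.succ (pairIdx iQ.2).2 (pairIdx iQ.2).1
        - w.curvRest U f x iQ.1 (pairIdx iQ.2).2 (pairIdx iQ.2).1)
      (Sum.elim
        (fun ij => ∑ k : Fin 3, w.a k ij.2 *
          (w.connection (f x) ij.1.succ k.succ 0 - w.connection (f x) ij.1.succ 0 k.succ))
        (Sum.elim (fun i => (U x)⁻¹ * partialDeriv i.succ U x)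
          (fun _ => w.muSource (w.connection (f x))))))

/-- The EDFF system as a first order symmetric system. -/
noncomputable def edffSystem (U : Spacetime → ℝ) (f : Spacetime → Fin 3 → Fin 3 → ℝ) :
    PfaffSystem EDFFIndex where
  M α _ _ := edffPrincipal α
  S := edffSource U f

/-! ### Smoothness, symmetry and positivity -/

section Smooth

variable {E : Type*} [NormedAddCommGroup E] [NormedSpace ℝ E] {s : Set E}

theorem contDiffOn_connActFour {G : E → Fin 4 → Fin 4 → Fin 4 → ℝ}
    {T : E → Fin 4 → Fin 4 → Fin 4 → Fin 4 → ℝ}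
    (hG : ∀ γ α β, ContDiffOn ℝ ∞ (fun p => G p γ α β) s)
    (hT : ∀ α β l m, ContDiffOn ℝ ∞ (fun p => T p α β l m) s) (σ α β l m : Fin 4) :
    ContDiffOn ℝ ∞ (fun p => connActFour (G p) (T p) σ α β l m) s :=
  ContDiffOn.sum fun r _ => ((((hG r σ α).mul (hT r β l m)).add ((hG r σ β).mul (hT α r l m))).add
    ((hG r σ l).mul (hT α β r m))).add ((hG r σ m).mul (hT α β l r))

theorem contDiffOn_connActTwo {G : E → Fin 4 → Fin 4 → Fin 4 → ℝ}
    {T : E → Fin 4 → Fin 4 → ℝ} (hG : ∀ γ α β, ContDiffOn ℝ ∞ (fun p => G p γ α β) s)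
    (hT : ∀ α β, ContDiffOn ℝ ∞ (fun p => T p α β) s) (σ α β : Fin 4) :
    ContDiffOn ℝ ∞ (fun p => connActTwo (G p) (T p) σ α β) s :=
  ContDiffOn.sum fun r _ => ((hG r σ α).mul (hT r β)).add ((hG r σ β).mul (hT α r))

theorem contDiffOn_dustSource {μ : E → ℝ} (hμ : ContDiffOn ℝ ∞ μ s) (α β : Fin 4) :
    ContDiffOn ℝ ∞ (fun p => dustSource (μ p) α β) s :=
  hμ.mul contDiffOn_const

theorem contDiffOn_curvShift_dustSource {μ : E → ℝ} (hμ : ContDiffOn ℝ ∞ μ s)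
    (α β l m : Fin 4) :
    ContDiffOn ℝ ∞ (fun p => curvShift (dustSource (μ p)) α β l m) s := by
  simp only [curvShift_dustSource_eq_mul (μ _)]
  exact hμ.mul contDiffOn_const

theorem contDiffOn_modifiedCurvature {w : E → EDFFState}
    (hw : ∀ i, ContDiffOn ℝ ∞ (fun p => w p i) s) (α β l m : Fin 4) :
    ContDiffOn ℝ ∞ (fun p => (w p).modifiedCurvature α β l m) s :=
  ContDiffOn.sum fun _ _ => ContDiffOn.sum fun _ _ => contDiffOn_const.mul (hw _)

theorem contDiffOn_riemann {w : E → EDFFState}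
    (hw : ∀ i, ContDiffOn ℝ ∞ (fun p => w p i) s) (α β l m : Fin 4) :
    ContDiffOn ℝ ∞ (fun p => (w p).riemann α β l m) s :=
  (contDiffOn_modifiedCurvature hw α β l m).sub (contDiffOn_curvShift_dustSource (hw _) α β l m)

theorem contDiffOn_connection {f : E → Fin 3 → Fin 3 → ℝ} {w : E → EDFFState}
    (hf : ∀ i j, ContDiffOn ℝ ∞ (fun p => f p i j) s)
    (hw : ∀ i, ContDiffOn ℝ ∞ (fun p => w p i) s) (γ α β : Fin 4) :
    ContDiffOn ℝ ∞ (fun p => (w p).connection (f p) γ α β) s := by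
  refine contDiffOn_const.mul ?_
  refine Fin.cases ?_ (fun i => ?_) α
  · refine Fin.cases ?_ (fun i => ?_) β
    · exact contDiffOn_const
    · refine Fin.cases ?_ (fun j => ?_) γ
      · exact contDiffOn_const
      · exact hf i j
  · simp only [EDFFState.connectionLow_succ]
    exact ContDiffOn.sum fun Q _ => contDiffOn_const.mul (hw _)

end Smooth

/-- In the state, the source is polynomial apart from a⁻¹, which enters when f is differentiated
along e_i; this is where det a ≠ 0 is needed. -/
theorem contDiffOn_edffSource {Ω : Set Spacetime} (hΩ : IsOpen Ω)
    {U : Spacetime → ℝ} (hU : ContDiffOn ℝ ∞ U Ω) (hU0 : ∀ x ∈ Ω, U x ≠ 0)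
    {f : Spacetime → Fin 3 → Fin 3 → ℝ} (hf : ContDiffOn ℝ ∞ f Ω) :
    ContDiffOn ℝ ∞ (fun p : Spacetime × EDFFState => edffSource U f p.1 p.2) (edffDomain Ω) := by
  have hfst {g : Spacetime → ℝ} (hg : ContDiffOn ℝ ∞ g Ω) :
      ContDiffOn ℝ ∞ (fun p : Spacetime × EDFFState => g p.1) (edffDomain Ω) :=
    hg.comp contDiffOn_fst fun p hp => hp.1
  have hw (i : EDFFIndex) :
      ContDiffOn ℝ ∞ (fun p : Spacetime × EDFFState => p.2 i) (edffDomain Ω) :=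
    contDiffOn_pi.1 contDiffOn_snd i
  have hf' (i j : Fin 3) : ContDiffOn ℝ ∞ (fun y => f y i j) Ω :=
    contDiffOn_pi.1 (contDiffOn_pi.1 hf i) j
  have hμ : ContDiffOn ℝ ∞ (fun p : Spacetime × EDFFState => p.2.mu) (edffDomain Ω) := hw _
  have hG := contDiffOn_connection (fun i j => hfst (hf' i j)) hw
  have hR := contDiffOn_riemann hw
  have hF := contDiffOn_modifiedCurvature hw
  have hν : ContDiffOn ℝ ∞ (fun p : Spacetime × EDFFState =>
      p.2.muSource (p.2.connection (f p.1))) (edffDomain Ω) :=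
    ((hw _).mul (ContDiffOn.sum fun i _ => hG _ _ _)).neg
  have hAR := contDiffOn_connActFour hG hR
  have hAF := contDiffOn_connActFour hG hF
  have hρ := contDiffOn_connActTwo hG (T := fun p => dustSource p.2.mu)
    (contDiffOn_dustSource (μ := fun p : Spacetime × EDFFState => p.2.mu) hμ)
  rw [contDiffOn_pi]
  rintro (⟨P, Q⟩ | ⟨i, Q⟩ | ⟨i, j⟩ | i | _)
  · simp only [edffSource, Sum.elim_inl, EDFFState.curvSource]
    split_ifs
    · exact ((hAR _ _ _ _ _).sub (ContDiffOn.sum fun h _ => hAR _ _ _ _ _)).sub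
        (((contDiffOn_dustSource hν _ _).sub (hρ _ _ _)).add (hρ _ _ _))
    · exact (hAR _ _ _ _ _).sub (ContDiffOn.sum fun h _ => hAF _ _ _ _ _)
    · exact (((contDiffOn_curvShift_dustSource hν _ _ _ _).add (hAR _ _ _ _ _)).add
        (hAR _ _ _ _ _)).sub (hAR _ _ _ _ _)
  · refine (hR _ _ _ _).sub (contDiffOn_const.mul (((ContDiffOn.sum fun ν _ => ?_).neg.sub
      (ContDiffOn.sum fun r _ => (hG _ _ _).mul ((hG _ _ _).sub (hG _ _ _)))).add
      (ContDiffOn.sum fun r _ => ((hG _ _ _).mul (hG _ _ _)).sub ((hG _ _ _).mul (hG _ _ _)))))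
    refine ContDiffOn.mul ?_ (hfst ?_)
    · exact contDiffOn_cfFrame (a := fun p : Spacetime × EDFFState => p.2.a)
        (b := fun p => p.2.b) (hfst hU) (fun p hp => hU0 _ hp.1) (fun _ _ => hw _)
        (fun p hp => hp.2) (fun _ => hw _) i.succ ν
    -- The coefficients ω_{0β,γ} do not depend on the state, so the zero state may stand for any
    -- other.
    · exact (contDiffOn_connection (w := fun _ => 0) hf' (fun _ => contDiffOn_const)
        _ _ _).partialDeriv hΩ ν
  · simp only [edffSource, Sum.elim_inl, Sum.elim_inr]
    exact ContDiffOn.sum fun k _ => (hw _).mul ((hG _ _ _).sub (hG _ _ _))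
  · exact hfst ((hU.inv hU0).mul (hU.partialDeriv hΩ i.succ))
  · exact hν

theorem bianchiSymbol_isSymm (ξ : Fin 4 → ℝ) : (bianchiSymbol ξ).IsSymm := by
  ext i j
  fin_cases i <;> fin_cases j <;> rfl

theorem edffPrincipal_isSymm (α : Fin 4) : (edffPrincipal α).IsSymm := by
  refine Matrix.IsSymm.fromBlocks ?_ (by simp) ?_
  · rw [Matrix.IsSymm, Matrix.blockDiagonal_transpose]
    simp only [(bianchiSymbol_isSymm _).eq]
  · split_ifs
    · exact Matrix.isSymm_one
    · exact Matrix.isSymm_zero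

theorem edffPrincipal_zero : edffPrincipal 0 = 1 := by
  have h : bianchiSymbol (Pi.single 0 1) = 1 := by
    ext i j
    fin_cases i <;> fin_cases j <;> simp [bianchiSymbol]
  have h' : (fun _ : Fin 6 => (1 : Matrix (Fin 6) (Fin 6) ℝ)) = 1 := rfl
  rw [edffPrincipal, h, h', if_pos rfl, Matrix.blockDiagonal_one, Matrix.fromBlocks_one]

theorem edffSystem_isQuasiFOSH {Ω : Set Spacetime} (hΩ : IsOpen Ω)
    {U : Spacetime → ℝ} (hU : ContDiffOn ℝ ∞ U Ω) (hU0 : ∀ x ∈ Ω, U x ≠ 0)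
    {f : Spacetime → Fin 3 → Fin 3 → ℝ} (hf : ContDiffOn ℝ ∞ f Ω) :
    (edffSystem U f).IsQuasiFOSH (edffDomain Ω) where
  smooth_principal _ _ _ := contDiffOn_const
  smooth_source := contDiffOn_edffSource hΩ hU hU0 hf
  symmetric α _ _ := edffPrincipal_isSymm α
  posDef _ _ := by
    change (edffPrincipal 0).PosDef
    rw [edffPrincipal_zero]
    exact Matrix.PosDef.one

/-! ### The principal part -/

theorem pairIdx_cases (P : Fin 6) :
    (∃ j : Fin 3, pairIdx P = (0, j.succ)) ∨ ∃ i j : Fin 3, pairIdx P = (i.succ, j.succ) := by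
  revert P
  decide

theorem exists_pairIdx_time (j : Fin 3) : ∃ P, pairIdx P = (0, j.succ) := by
  revert j
  decide

theorem exists_pairIdx_space (i j : Fin 3) :
    i = j ∨ ∃ P, pairIdx P = (i.succ, j.succ) ∨ pairIdx P = (j.succ, i.succ) := by
  revert i j
  decide

/-- An antisymmetric spatial tensor vanishes if its components on the pairs `pairIdx P` do. -/
theorem eq_zero_of_pairIdx {t : Fin 3 → Fin 3 → ℝ} (ht : ∀ i j, t j i = -t i j)
    (h : ∀ P i j, pairIdx P = (i.succ, j.succ) → t i j = 0) (i j : Fin 3) : t i j = 0 := by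
  rcases exists_pairIdx_space i j with rfl | ⟨P, hP | hP⟩
  · linarith [ht i i]
  · exact h P i j hP
  · rw [ht, h P j i hP, neg_zero]

/-- The principal part of the equations for the curvature unknowns, for derivatives `t s` of the
curvature components with a fixed second pair of indices. -/
def curvPrincipal (t : Fin 4 → Fin 4 → Fin 4 → ℝ) (α β : Fin 4) : ℝ :=
  if α = 0 then t 0 α β - ∑ h : Fin 3, t h.succ h.succ β else t 0 α β + t β 0 α - t α 0 β

/-- The rows of the matrix are matched with the curl and divergence. The order 31, rather than 13,
fixes the signs, and the components 21, 32, 13 in the divergence are turned by antisymmetry. -/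
theorem sum_edffPrincipal_mulVec_inl (D : Fin 4 → EDFFState) (P Q : Fin 6) :
    (∑ α, (edffPrincipal α).mulVec (D α)) (Sum.inl (P, Q))
      = curvPrincipal (fun s α β => (D s).modifiedCurvature α β (pairIdx Q).1 (pairIdx Q).2)
        (pairIdx P).1 (pairIdx P).2 := by
  have h1 (α : Fin 4) : (edffPrincipal α).mulVec (D α) (Sum.inl (P, Q))
      = ∑ P', bianchiSymbol (Pi.single α 1) P P' * (D α).curv P' Q := by
    simp [edffPrincipal, Matrix.mulVec, dotProduct, Matrix.blockDiagonal_apply,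
      Fintype.sum_prod_type, EDFFState.curv]
  have hp (s : Fin 4) (P' : Fin 6) := (D s).modifiedCurvature_pairIdx P' Q
  have ha (s : Fin 4) := (D s).modifiedCurvature_antisymm_left
  have hd (s α l m : Fin 4) : (D s).modifiedCurvature α α l m = 0 := by
    linarith [ha s α α l m]
  rw [Finset.sum_apply]
  simp only [h1, ← hp]
  clear h1 hp
  generalize (pairIdx Q).1 = l
  generalize (pairIdx Q).2 = m
  have h21 (s : Fin 4) := ha s 1 2
  have h32 (s : Fin 4) := ha s 2 3
  have h13 (s : Fin 4) := ha s 3 1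
  fin_cases P <;>
    simp [Fin.sum_univ_succ, bianchiSymbol, pairIdx, curvPrincipal, hd, h21, h32, h13] <;> ring

theorem sum_edffPrincipal_mulVec_inr (D : Fin 4 → EDFFState)
    (k : (Fin 3 × Fin 6) ⊕ ((Fin 3 × Fin 3) ⊕ (Fin 3 ⊕ Unit))) :
    (∑ α, (edffPrincipal α).mulVec (D α)) (Sum.inr k) = D 0 (Sum.inr k) := by
  rw [Finset.sum_apply, Fin.sum_univ_succ]
  simp [edffPrincipal, Matrix.fromBlocks_mulVec]

/-! ### The EDFF system in symmetric form -/

/-- The Pfaff derivatives at a point of the unknowns. -/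
noncomputable def edffJet (U : Spacetime → ℝ) (v : Spacetime → EDFFState) (x : Spacetime)
    (s : Fin 4) : EDFFState :=
  fun i => pfaff (edffFrame U v) s (fun y => v y i) x

section Equivalence

variable {Ω : Set Spacetime} {U : Spacetime → ℝ} {f : Spacetime → Fin 3 → Fin 3 → ℝ}
  {v : Spacetime → EDFFState} {x : Spacetime}

theorem pfaff_modifiedCurvature (hv : DifferentiableAt ℝ v x) (s α β l m : Fin 4) :
    pfaff (edffFrame U v) s (fun y => (v y).modifiedCurvature α β l m) x
      = (edffJet U v x s).modifiedCurvature α β l m :=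
  pfaff_linear (edffFrame U v) s
    { toFun := fun w : EDFFState => w.modifiedCurvature α β l m
      map_add' := fun w w' => by
        simp [EDFFState.modifiedCurvature, EDFFState.curv, mul_add, Finset.sum_add_distrib]
      map_smul' := fun c w => by
        simp [EDFFState.modifiedCurvature, EDFFState.curv, Finset.mul_sum, mul_left_comm] } hv

/-- With a spatial first index the coefficient is linear in the state and does not contain f, so no
derivative of f appears. -/
theorem pfaff_connectionLow (hv : DifferentiableAt ℝ v x) (s : Fin 4) (i : Fin 3)
    (β γ : Fin 4) :
    pfaff (edffFrame U v) s (fun y => (v y).connectionLow (f y) i.succ β γ) x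
      = (edffJet U v x s).connectionLow (f x) i.succ β γ :=
  pfaff_linear (edffFrame U v) s
    { toFun := fun w : EDFFState => ∑ Q, bivector Q β γ * w.conn i Q
      map_add' := fun w w' => by
        simp [EDFFState.conn, mul_add, Finset.sum_add_distrib]
      map_smul' := fun c w => by
        simp [EDFFState.conn, Finset.mul_sum, mul_left_comm] } hv

theorem pfaff_dustSource (s α β : Fin 4) :
    pfaff (edffFrame U v) s (fun y => dustSource (v y).mu α β) x
      = dustSource (edffJet U v x s).mu α β := by
  simp only [dustSource, mul_comm (EDFFState.mu _), pfaff_const_mul]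
  rfl

theorem pfaff_curvShift (s α β l m : Fin 4) :
    pfaff (edffFrame U v) s (fun y => curvShift (dustSource (v y).mu) α β l m) x
      = curvShift (dustSource (edffJet U v x s).mu) α β l m := by
  simp only [curvShift_dustSource_eq_mul (EDFFState.mu _), mul_comm (EDFFState.mu _),
    pfaff_const_mul]
  rfl

theorem pfaff_riemann (hv : DifferentiableAt ℝ v x) (s α β l m : Fin 4) :
    pfaff (edffFrame U v) s (fun y => (v y).riemann α β l m) x
      = (edffJet U v x s).modifiedCurvature α β l m
        - curvShift (dustSource (edffJet U v x s).mu) α β l m := by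
  have hi (i : EDFFIndex) : DifferentiableAt ℝ (fun y => v y i) x := differentiableAt_pi.1 hv i
  rw [← pfaff_modifiedCurvature hv, ← pfaff_curvShift]
  refine pfaff_sub _ _ ?_ ?_
  · exact DifferentiableAt.fun_sum fun P _ => DifferentiableAt.fun_sum fun Q _ =>
      (hi _).const_mul _
  · simp only [curvShift_dustSource_eq_mul (EDFFState.mu _)]
    exact (hi _).mul_const _

theorem covDerivFour_modifiedCurvature (hv : DifferentiableAt ℝ v x) (s α β l m : Fin 4) :
    covDerivFour (edffFrame U v) (edffConnection f v) (fun y => (v y).modifiedCurvature) s α β l m x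
      = (edffJet U v x s).modifiedCurvature α β l m
        - connActFour ((v x).connection (f x)) (v x).modifiedCurvature s α β l m := by
  rw [← pfaff_modifiedCurvature hv]
  rfl

theorem covDerivFour_curvShift (s α β l m : Fin 4) :
    covDerivFour (edffFrame U v) (edffConnection f v) (fun y => curvShift (dustSource (v y).mu))
      s α β l m x
      = curvShift (dustSource (edffJet U v x s).mu) α β l m
        - connActFour ((v x).connection (f x)) (curvShift (dustSource (v x).mu)) s α β l m := by
  rw [← pfaff_curvShift]
  rfl

theorem covDerivFour_riemann (hv : DifferentiableAt ℝ v x) (s α β l m : Fin 4) :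
    covDerivFour (edffFrame U v) (edffConnection f v) (fun y => (v y).riemann) s α β l m x
      = (edffJet U v x s).modifiedCurvature α β l m
        - curvShift (dustSource (edffJet U v x s).mu) α β l m
        - connActFour ((v x).connection (f x)) (v x).riemann s α β l m := by
  rw [← pfaff_riemann hv]
  rfl

theorem covDerivTwo_dustSource (s α β : Fin 4) :
    covDerivTwo (edffFrame U v) (edffConnection f v) (fun y => dustSource (v y).mu) s α β x
      = dustSource (edffJet U v x s).mu α β
        - connActTwo ((v x).connection (f x)) (dustSource (v x).mu) s α β := by
  rw [← pfaff_dustSource]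
  rfl

theorem connActFour_riemann (G : Fin 4 → Fin 4 → Fin 4 → ℝ) (w : EDFFState)
    (s α β l m : Fin 4) :
    connActFour G w.riemann s α β l m = connActFour G w.modifiedCurvature s α β l m
      - connActFour G (curvShift (dustSource w.mu)) s α β l m := by
  simp only [connActFour, ← Finset.sum_sub_distrib]
  refine Finset.sum_congr rfl fun r _ => ?_
  simp only [EDFFState.riemann]
  ring

theorem sum_edffPrincipal_eq_iff (P Q : Fin 6) :
    (∑ α, (edffPrincipal α).mulVec (edffJet U v x α)) (Sum.inl (P, Q))
        = edffSource U f x (v x) (Sum.inl (P, Q))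
      ↔ curvPrincipal (fun s α β => (edffJet U v x s).modifiedCurvature α β
          (pairIdx Q).1 (pairIdx Q).2) (pairIdx P).1 (pairIdx P).2
        = (v x).curvSource ((v x).connection (f x)) (pairIdx P).1 (pairIdx P).2
          (pairIdx Q).1 (pairIdx Q).2 := by
  rw [sum_edffPrincipal_mulVec_inl]
  rfl

/-- This and the three identities after it compare an EDFF equation with a row of the symmetric
system. Under a space derivative the shift always carries an index 0 and vanishes, or is absorbed in
F; ρ_{0i} vanishes as well. Any remaining ∂_0 μ is replaced through `hμ`. The contracted equations
appear with a minus sign because R⁰_i = -R_{0i}. -/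
theorem bianchi_zero_eq (hv : DifferentiableAt ℝ v x)
    (hμ : (edffJet U v x 0).mu = (v x).muSource ((v x).connection (f x))) (h k : Fin 3)
    (m : Fin 4) :
    covDerivFour (edffFrame U v) (edffConnection f v) (fun y => (v y).riemann)
        0 h.succ k.succ 0 m x
      + covDerivFour (edffFrame U v) (edffConnection f v) (fun y => (v y).riemann)
        k.succ 0 h.succ 0 m x
      - covDerivFour (edffFrame U v) (edffConnection f v) (fun y => (v y).riemann)
        h.succ 0 k.succ 0 m x
      = curvPrincipal (fun s α β => (edffJet U v x s).modifiedCurvature α β 0 m) h.succ k.succ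
        - (v x).curvSource ((v x).connection (f x)) h.succ k.succ 0 m := by
  simp only [covDerivFour_riemann hv, hμ, curvPrincipal, EDFFState.curvSource,
    Fin.succ_ne_zero, if_false, curvShift_dustSource_of_zero, true_or, or_true]
  ring

theorem bianchi_space_eq (hv : DifferentiableAt ℝ v x)
    (hμ : (edffJet U v x 0).mu = (v x).muSource ((v x).connection (f x))) (i j h k : Fin 3) :
    covDerivFour (edffFrame U v) (edffConnection f v) (fun y => (v y).modifiedCurvature)
        0 i.succ j.succ h.succ k.succ x
      + covDerivFour (edffFrame U v) (edffConnection f v) (fun y => (v y).riemann)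
        j.succ 0 i.succ h.succ k.succ x
      - covDerivFour (edffFrame U v) (edffConnection f v) (fun y => (v y).riemann)
        i.succ 0 j.succ h.succ k.succ x
      - covDerivFour (edffFrame U v) (edffConnection f v)
        (fun y => curvShift (dustSource (v y).mu)) 0 i.succ j.succ h.succ k.succ x
      = curvPrincipal (fun s α β => (edffJet U v x s).modifiedCurvature α β h.succ k.succ)
          i.succ j.succ
        - (v x).curvSource ((v x).connection (f x)) i.succ j.succ h.succ k.succ := by
  simp only [covDerivFour_riemann hv, covDerivFour_modifiedCurvature hv, covDerivFour_curvShift,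
    hμ, curvPrincipal, EDFFState.curvSource, connActFour_riemann, Fin.succ_ne_zero, if_false,
    curvShift_dustSource_of_zero, true_or]
  ring

theorem contracted_zero_eq (hv : DifferentiableAt ℝ v x)
    (hμ : (edffJet U v x 0).mu = (v x).muSource ((v x).connection (f x))) (i j : Fin 3) :
    (-covDerivFour (edffFrame U v) (edffConnection f v) (fun y => (v y).riemann)
        0 0 i.succ 0 j.succ x
      + ∑ h : Fin 3, covDerivFour (edffFrame U v) (edffConnection f v) (fun y => (v y).riemann)
        h.succ h.succ i.succ 0 j.succ x)
      - (covDerivTwo (edffFrame U v) (edffConnection f v) (fun y => dustSource (v y).mu)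
          0 j.succ i.succ x
        - covDerivTwo (edffFrame U v) (edffConnection f v) (fun y => dustSource (v y).mu)
          j.succ 0 i.succ x)
      = -(curvPrincipal (fun s α β => (edffJet U v x s).modifiedCurvature α β 0 j.succ) 0 i.succ
        - (v x).curvSource ((v x).connection (f x)) 0 i.succ 0 j.succ) := by
  simp only [covDerivFour_riemann hv, covDerivTwo_dustSource, hμ, curvPrincipal,
    EDFFState.curvSource, if_true, curvShift_dustSource_of_zero, true_or, or_true,
    dustSource_zero_succ, Finset.sum_sub_distrib, Finset.sum_const_zero]
  ring

theorem contracted_space_eq (hv : DifferentiableAt ℝ v x) (i h j : Fin 3) :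
    -covDerivFour (edffFrame U v) (edffConnection f v) (fun y => (v y).riemann)
        0 0 i.succ h.succ j.succ x
      + ∑ k : Fin 3,
        covDerivFour (edffFrame U v) (edffConnection f v) (fun y => (v y).modifiedCurvature)
          k.succ k.succ i.succ h.succ j.succ x
      = -(curvPrincipal (fun s α β => (edffJet U v x s).modifiedCurvature α β h.succ j.succ)
          0 i.succ
        - (v x).curvSource ((v x).connection (f x)) 0 i.succ h.succ j.succ) := by
  simp only [covDerivFour_riemann hv, covDerivFour_modifiedCurvature hv, curvPrincipal,
    EDFFState.curvSource, if_true, curvShift_dustSource_of_zero, true_or,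
    Fin.succ_ne_zero, if_false, Finset.sum_sub_distrib]
  ring

theorem connectionLow_pairIdx (g : Fin 3 → Fin 3 → ℝ) (w : EDFFState) (i : Fin 3) (Q : Fin 6) :
    w.connectionLow g i.succ (pairIdx Q).1 (pairIdx Q).2 = w.conn i Q := by
  simp [EDFFState.connectionLow_succ, bivector_pairIdx]

/-- The curvature R_{0i,γβ} contains ∂_0 ω_{iβ,γ} and ∂_i ω_{0β,γ}. The second is a derivative of
the given f, or zero, and belongs to the source; so ∂_0 alone acts on the connection unknowns. -/
theorem curvatureLow_edff (hv : DifferentiableAt ℝ v x) (i : Fin 3) (γ β : Fin 4) :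
    curvatureLow (edffFrame U v) (edffConnection f v) 0 i.succ γ β x
      = (edffJet U v x 0).connectionLow (f x) i.succ β γ + (v x).curvRest U f x i γ β := by
  have h1 : pfaff (edffFrame U v) 0 (fun y => edffConnection f v y γ i.succ β) x
      = minkowski γ γ * (edffJet U v x 0).connectionLow (f x) i.succ β γ := by
    rw [← pfaff_connectionLow hv, ← pfaff_const_mul]
    rfl
  -- True by definition, because ω^γ_{0β} is the same for every state, including the state 0 used in
  -- `curvRest`.
  have h2 : pfaff (edffFrame U v) i.succ (fun y => edffConnection f v y γ 0 β) x
      = ∑ ν, cfFrame (U x) (v x).a (v x).b i.succ ν *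
        partialDeriv ν (fun y => EDFFState.connection (f y) 0 γ 0 β) x := rfl
  have h3 := minkowski_mul_self γ
  rw [curvatureLow, curvature, h1, h2, EDFFState.curvRest]
  simp only [edffConnection]
  linear_combination (edffJet U v x 0).connectionLow (f x) i.succ β γ * h3

theorem edffSystem_isSolution_iff :
    (edffSystem U f).IsSolution Ω (edffFrame U v) v ↔ ∀ x ∈ Ω,
      (∀ P Q, curvPrincipal (fun s α β => (edffJet U v x s).modifiedCurvature α β
          (pairIdx Q).1 (pairIdx Q).2) (pairIdx P).1 (pairIdx P).2
        = (v x).curvSource ((v x).connection (f x)) (pairIdx P).1 (pairIdx P).2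
          (pairIdx Q).1 (pairIdx Q).2) ∧
      (∀ i Q, (edffJet U v x 0).conn i Q = (v x).riemann 0 i.succ (pairIdx Q).2 (pairIdx Q).1
        - (v x).curvRest U f x i (pairIdx Q).2 (pairIdx Q).1) ∧
      (∀ i j, (edffJet U v x 0).a i j = ∑ k : Fin 3, (v x).a k j *
        (edffConnection f v x i.succ k.succ 0 - edffConnection f v x i.succ 0 k.succ)) ∧
      (∀ i, (edffJet U v x 0).b i = (U x)⁻¹ * partialDeriv i.succ U x) ∧
      (edffJet U v x 0).mu = (v x).muSource ((v x).connection (f x)) := by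
  have h : (edffSystem U f).IsSolution Ω (edffFrame U v) v ↔ ∀ x ∈ Ω,
      ∑ α, (edffPrincipal α).mulVec (edffJet U v x α) = edffSource U f x (v x) := Iff.rfl
  rw [h]
  refine forall₂_congr fun x _ => ?_
  rw [funext_iff, Sum.forall, Prod.forall]
  simp only [sum_edffPrincipal_eq_iff]
  refine and_congr Iff.rfl ?_
  simp only [sum_edffPrincipal_mulVec_inr, Sum.forall, Prod.forall]
  exact and_congr Iff.rfl (and_congr Iff.rfl (and_congr Iff.rfl ⟨fun h => h (), fun h _ => h⟩))

/-- The EDFF system is equivalent to its symmetric form. -/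
theorem edffEquations_iff (hΩ : IsOpen Ω) (hf : ∀ x ∈ Ω, ∀ i j : Fin 3, f x j i = -f x i j)
    (hv : DifferentiableOn ℝ v Ω) :
    EDFFEquations Ω U f v ↔ (edffSystem U f).IsSolution Ω (edffFrame U v) v := by
  have hvx (x : Spacetime) (hx : x ∈ Ω) : DifferentiableAt ℝ v x :=
    hv.differentiableAt (hΩ.mem_nhds hx)
  have hμ (x : Spacetime) : pfaff (edffFrame U v) 0 (fun y => (v y).mu) x
      + (v x).mu * ∑ i : Fin 3, edffConnection f v x i.succ i.succ 0 = 0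
      ↔ (edffJet U v x 0).mu = (v x).muSource ((v x).connection (f x)) := add_eq_zero_iff_eq_neg
  rw [edffSystem_isSolution_iff]
  constructor
  · intro H x hx
    have hm := (hμ x).1 (H.density x hx)
    refine ⟨fun P Q => ?_, fun i Q => ?_, H.frame_space x hx, H.frame_time x hx, hm⟩
    · rcases pairIdx_cases P with ⟨i, hP⟩ | ⟨i, k, hP⟩ <;>
        rcases pairIdx_cases Q with ⟨j, hQ⟩ | ⟨l, m, hQ⟩ <;> rw [hP, hQ, ← sub_eq_zero]
      · rw [← neg_eq_zero, ← contracted_zero_eq (hvx x hx) hm, sub_eq_zero]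
        exact H.contracted_zero x hx i j
      · rw [← neg_eq_zero, ← contracted_space_eq (hvx x hx)]
        exact H.contracted_space x hx i l m
      · rw [← bianchi_zero_eq (hvx x hx) hm]
        exact H.bianchi_zero x hx i k j
      · rw [← bianchi_space_eq (hvx x hx) hm, sub_eq_zero]
        exact H.bianchi_space x hx i k l m
    -- The pair Q is reversed in the curvature: R_{0i,γβ} governs ω_{iβ,γ}, whose pair is (β, γ).
    · rw [← connectionLow_pairIdx (f x), eq_sub_iff_add_eq, ← curvatureLow_edff (hvx x hx)]
      rcases pairIdx_cases Q with ⟨j, hQ⟩ | ⟨l, m, hQ⟩ <;> rw [hQ]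
      · exact H.connection_time x hx i j
      · exact H.connection_space x hx i m l
  · intro H
    -- The symmetric system gives the equations only on the ordered pairs of `pairIdx`. Covariant
    -- derivatives preserve antisymmetry in each pair, so these determine the equations for all
    -- indices.
    have hRl (x : Spacetime) (hx : x ∈ Ω) := covDerivFour_antisymm_left hΩ hx (edffFrame U v)
      (edffConnection f v) (T := fun y => (v y).riemann) fun y _ => (v y).riemann_antisymm_left
    have hRr (x : Spacetime) (hx : x ∈ Ω) := covDerivFour_antisymm_right hΩ hx (edffFrame U v)
      (edffConnection f v) (T := fun y => (v y).riemann) fun y _ => (v y).riemann_antisymm_right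
    have hFl (x : Spacetime) (hx : x ∈ Ω) := covDerivFour_antisymm_left hΩ hx (edffFrame U v)
      (edffConnection f v) (T := fun y => (v y).modifiedCurvature)
      fun y _ => (v y).modifiedCurvature_antisymm_left
    have hFr (x : Spacetime) (hx : x ∈ Ω) := covDerivFour_antisymm_right hΩ hx (edffFrame U v)
      (edffConnection f v) (T := fun y => (v y).modifiedCurvature)
      fun y _ => (v y).modifiedCurvature_antisymm_right
    have hCl (x : Spacetime) (hx : x ∈ Ω) := covDerivFour_antisymm_left hΩ hx (edffFrame U v)
      (edffConnection f v) (T := fun y => curvShift (dustSource (v y).mu))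
      fun y _ => curvShift_antisymm_left _
    have hCr (x : Spacetime) (hx : x ∈ Ω) := covDerivFour_antisymm_right hΩ hx (edffFrame U v)
      (edffConnection f v) (T := fun y => curvShift (dustSource (v y).mu))
      fun y _ => curvShift_antisymm_right _
    have hconn (x : Spacetime) (hx : x ∈ Ω) (i : Fin 3) (Q : Fin 6) :
        curvatureLow (edffFrame U v) (edffConnection f v) 0 i.succ (pairIdx Q).2 (pairIdx Q).1 x
          = (v x).riemann 0 i.succ (pairIdx Q).2 (pairIdx Q).1 := by
      rw [curvatureLow_edff (hvx x hx), connectionLow_pairIdx, (H x hx).2.1 i Q]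
      ring
    refine ⟨fun x hx h k j => ?_, fun x hx i j => ?_, fun x hx i j h k => ?_,
      fun x hx i h j => ?_, fun x hx h i j => ?_, fun x hx h i => ?_,
      fun x hx => (H x hx).2.2.1, fun x hx => (H x hx).2.2.2.1,
      fun x hx => (hμ x).2 (H x hx).2.2.2.2⟩
    · refine eq_zero_of_pairIdx (t := fun h k => covDerivFour (edffFrame U v) (edffConnection f v)
        (fun y => (v y).riemann) 0 h.succ k.succ 0 j.succ x
        + covDerivFour (edffFrame U v) (edffConnection f v) (fun y => (v y).riemann)
          k.succ 0 h.succ 0 j.succ x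
        - covDerivFour (edffFrame U v) (edffConnection f v) (fun y => (v y).riemann)
          h.succ 0 k.succ 0 j.succ x) (fun h k => ?_) (fun P h k hP => ?_) h k
      · linarith [hRl x hx 0 h.succ k.succ 0 j.succ]
      · obtain ⟨Q, hQ⟩ := exists_pairIdx_time j
        rw [bianchi_zero_eq (hvx x hx) (H x hx).2.2.2.2, sub_eq_zero]
        simpa only [hP, hQ] using (H x hx).1 P Q
    · obtain ⟨P, hP⟩ := exists_pairIdx_time i
      obtain ⟨Q, hQ⟩ := exists_pairIdx_time j
      rw [← sub_eq_zero, contracted_zero_eq (hvx x hx) (H x hx).2.2.2.2, neg_eq_zero, sub_eq_zero]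
      simpa only [hP, hQ] using (H x hx).1 P Q
    · rw [← sub_eq_zero]
      refine eq_zero_of_pairIdx (t := fun i j => covDerivFour (edffFrame U v) (edffConnection f v)
          (fun y => (v y).modifiedCurvature) 0 i.succ j.succ h.succ k.succ x
        + covDerivFour (edffFrame U v) (edffConnection f v) (fun y => (v y).riemann)
          j.succ 0 i.succ h.succ k.succ x
        - covDerivFour (edffFrame U v) (edffConnection f v) (fun y => (v y).riemann)
          i.succ 0 j.succ h.succ k.succ x
        - covDerivFour (edffFrame U v) (edffConnection f v)
          (fun y => curvShift (dustSource (v y).mu)) 0 i.succ j.succ h.succ k.succ x)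
        (fun i j => ?_) (fun P i j hP => ?_) i j
      · linarith [hFl x hx 0 i.succ j.succ h.succ k.succ, hCl x hx 0 i.succ j.succ h.succ k.succ]
      refine eq_zero_of_pairIdx (t := fun h k => covDerivFour (edffFrame U v) (edffConnection f v)
          (fun y => (v y).modifiedCurvature) 0 i.succ j.succ h.succ k.succ x
        + covDerivFour (edffFrame U v) (edffConnection f v) (fun y => (v y).riemann)
          j.succ 0 i.succ h.succ k.succ x
        - covDerivFour (edffFrame U v) (edffConnection f v) (fun y => (v y).riemann)
          i.succ 0 j.succ h.succ k.succ x
        - covDerivFour (edffFrame U v) (edffConnection f v)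
          (fun y => curvShift (dustSource (v y).mu)) 0 i.succ j.succ h.succ k.succ x)
        (fun h k => ?_) (fun Q h k hQ => ?_) h k
      · linarith [hFr x hx 0 i.succ j.succ h.succ k.succ, hCr x hx 0 i.succ j.succ h.succ k.succ,
          hRr x hx j.succ 0 i.succ h.succ k.succ, hRr x hx i.succ 0 j.succ h.succ k.succ]
      · rw [bianchi_space_eq (hvx x hx) (H x hx).2.2.2.2, sub_eq_zero]
        simpa only [hP, hQ] using (H x hx).1 P Q
    · obtain ⟨P, hP⟩ := exists_pairIdx_time i
      refine eq_zero_of_pairIdx (t := fun h j => -covDerivFour (edffFrame U v) (edffConnection f v)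
          (fun y => (v y).riemann) 0 0 i.succ h.succ j.succ x
        + ∑ k : Fin 3, covDerivFour (edffFrame U v) (edffConnection f v)
          (fun y => (v y).modifiedCurvature) k.succ k.succ i.succ h.succ j.succ x)
        (fun h j => ?_) (fun Q h j hQ => ?_) h j
      · simp only [hRr x hx _ _ _ h.succ j.succ, hFr x hx _ _ _ h.succ j.succ,
          Finset.sum_neg_distrib, neg_add]
      · rw [contracted_space_eq (hvx x hx), neg_eq_zero, sub_eq_zero]
        simpa only [hP, hQ] using (H x hx).1 P Q
    · rw [← sub_eq_zero]
      refine eq_zero_of_pairIdx (t := fun j i => curvatureLow (edffFrame U v) (edffConnection f v)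
        0 h.succ i.succ j.succ x - (v x).riemann 0 h.succ i.succ j.succ)
        (fun j i => ?_) (fun Q j i hQ => ?_) j i
      -- Antisymmetry of f enters: it makes the unknown connection metric, hence the curvature side
      -- antisymmetric in the second pair like the unknown tensor.
      · rw [(v x).riemann_antisymm_right _ _ i.succ j.succ, curvatureLow_antisymm_right hΩ
          (Γ := edffConnection f v) (fun y hy => EDFFState.connection_metric (hf y hy) (v y)) hx
          0 h.succ i.succ j.succ]
        ring
      · have := hconn x hx h Q
        rw [hQ] at this
        exact sub_eq_zero.2 this
    · obtain ⟨Q, hQ⟩ := exists_pairIdx_time i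
      have := hconn x hx h Q
      rwa [hQ] at this

end Equivalence

/-! ### The quasi FOSH theorem -/

theorem mainTheorem2 (Ω : Set Spacetime) (hΩ : IsOpen Ω)
    (U : Spacetime → ℝ) (hU : ContDiffOn ℝ ∞ U Ω) (hU0 : ∀ x ∈ Ω, U x ≠ 0)
    (f : Spacetime → Fin 3 → Fin 3 → ℝ) (hf : ContDiffOn ℝ ∞ f Ω)
    (hf_anti : ∀ x ∈ Ω, ∀ i j, f x j i = -f x i j) :
    ∃ P : PfaffSystem EDFFIndex,
      P.IsQuasiFOSH (edffDomain Ω) ∧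
      (∀ α x w, P.M α x w = edffPrincipal α) ∧
      (∀ v : Spacetime → EDFFState, DifferentiableOn ℝ v Ω →
        (∀ x ∈ Ω, (x, v x) ∈ edffDomain Ω) →
        (EDFFEquations Ω U f v ↔ P.IsSolution Ω (edffFrame U v) v)) ∧
      ∀ (a : Spacetime → Fin 3 → Fin 3 → ℝ) (b : Spacetime → Fin 3 → ℝ) (μ : Spacetime → ℝ),
        ContDiffOn ℝ ∞ a Ω → ContDiffOn ℝ ∞ b Ω → ContDiffOn ℝ ∞ μ Ω →
        (∀ x ∈ Ω, (Matrix.of (a x)).det ≠ 0) →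
        IsEinsteinDust Ω U a b μ →
        (∀ x ∈ Ω, ∀ i j : Fin 3, cfConnection U a b x j.succ 0 i.succ = f x i j) →
        EDFFEquations Ω U f (edffUnknowns U a b μ) ∧
          P.IsSolution Ω (edffFrame U (edffUnknowns U a b μ)) (edffUnknowns U a b μ) := by
  refine ⟨edffSystem U f, edffSystem_isQuasiFOSH hΩ hU hU0 hf, fun _ _ _ => rfl,
    fun v hv _ => edffEquations_iff hΩ hf_anti hv, fun a b μ ha hb hμ ha0 hE hfc => ?_⟩
  have H := isLeviCivita_cf hΩ hU hU0 ha ha0 hb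
  have hEq := hE.edffEquations hΩ hU0 ha0 hμ H hfc
  have hv : DifferentiableOn ℝ (edffUnknowns U a b μ) Ω :=
    (hE.contDiffOn_edffUnknowns hΩ ha hb hμ H).differentiableOn (by simp)
  exact ⟨hEq, (edffEquations_iff hΩ hf_anti hv).1 hEq⟩
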